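/- Throughout, $\log$ is in base 2, $\ln$ is the natural logarithm, $\mathbb{N}=\{1,2,\dots\}$, and expectations and divergences may be $+\infty$. For probability measures $P\ll Q$ let $D(P\|Q)$ be the Kullback–Leibler divergence in bits and, for $\beta>1$, $D_\beta(P\|Q)=\frac{1}{\beta-1}\log\mathbb{E}_{X\sim Q}\big[\big(\tfrac{dP}{dQ}(X)\big)^\beta\big]$ the Rényi divergence of order $\beta$. Let $\epsilon>0$, and put $c(\epsilon)=1+\log\big(\tfrac{\ln 2}{\epsilon}+\tfrac32\big)$ and $c_2(\epsilon)=3+\epsilon+\log\big(\tfrac{\ln 2}{\epsilon}+\tfrac32\big)$. (1) There is a universal code $\mathcal{C}:\mathbb{N}\to\{0,1\}^*$, that is, a prefix-free binary code for which there is a constant $A<\infty$ such that the expected codeword length is at most $A\max(1,H(p))$ for every nonincreasing probability distribution $p$ on $\mathbb{N}$ with entropy $H(p)$, such that the codeword lengths $n_k$ satisfy, for all $k\ge1$, $$\log k+(1+\epsilon)\log\log(k+1)\;\le\; n_k\;\le\;\log k+(1+\epsilon)\log\log(k+1)+c(\epsilon).$$ (2) Let $\mathcal{C}:\mathbb{N}\to\{0,1\}^*$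 be any code whose codeword lengths $n_k$ satisfy the upper bound in (1); in particular $\mathcal C$ may be chosen depending on $\epsilon$ only. Let $P\ll Q$ be probability measures on a Polish space, let $T_1<T_2<\cdots$ be the arrival times of a rate-one Poisson process, let $U_1,U_2,\dots$ be i.i.d. with law $Q$ and independent of $(T_i)$, and let $$K=\operatorname*{arg\,min}_{i\ge1}\frac{T_i}{\frac{dP}{dQ}(U_i)}$$ be the output of the Poisson functional representation. For $t>0$ let $L(t)=\frac1t\log\mathbb{E}\big[2^{t n_K}\big]$. Then: (a) for all $\alpha$ with $2/3<\alpha<1$ and $\epsilon\le\frac{3\alpha-2}{2-2\alpha}$, with $t=\frac{1-\alpha}{\alpha}$, $$L(t)\le D_{\frac{2-\alpha}{\alpha}}(P\|Q)+(1+\epsilon)\log\big(D(P\|Q)+1\big)+c_2(\epsilon);$$ (b) $\mathbb{E}[n_K]\le D(P\|Q)+(1+\epsilon)\log\big(D(P\|Q)+1\big)+c_2(\epsilon)$, the bound of Harsha et al.; (c) if $D_\beta(P\|Q)<\infty$ for some $\beta>1$, then, as $\alpha\uparrow1$ with $\epsilon$ fixed, the left and right sides of the inequality in (a) converge to the left and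 right sides, respectively, of the inequality in (b). -/

import Mathlib

open MeasureTheory ProbabilityTheory Filter Topology
open scoped ENNReal

noncomputable section

/-- Base-two logarithm on `[0, ∞]`, with `log 0 = -∞` and `log ∞ = ∞`. -/
def log2E (x : ℝ≥0∞) : EReal := ENNReal.log x / ((Real.log 2 : ℝ) : EReal)

/-- Kullback-Leibler divergence `D(P‖Q)` in bits (Mathlib's `klDiv` is in nats). -/
def klBits {U : Type*} [MeasurableSpace U] (P Q : Measure U) : ℝ≥0∞ :=
  InformationTheory.klDiv P Q / ENNReal.ofReal (Real.log 2)

/-- Rényi divergence of order `β ∈ (0, 1) ∪ (1, ∞)` in bits, for `P ≪ Q`: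
`D_β(P‖Q) = 1 / (β - 1) * log₂ E_{X ∼ Q}[(dP/dQ (X)) ^ β]`. -/
def renyiDiv {U : Type*} [MeasurableSpace U] (β : ℝ) (P Q : Measure U) : EReal :=
  (((β - 1)⁻¹ : ℝ) : EReal) * log2E (∫⁻ x, (P.rnDeriv Q x) ^ β ∂Q)

/-- `T 0, T 1, …` are the successive arrival times of a rate-one Poisson process: the gaps
`T 0, T 1 - T 0, T 2 - T 1, …` are i.i.d. exponential with parameter one. -/
structure IsPoissonArrivals {Ω : Type*} [MeasurableSpace Ω] (μ : Measure Ω)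
    (T : ℕ → Ω → ℝ) : Prop where
  measurable : ∀ i, Measurable (T i)
  indep_gaps : iIndepFun (fun (i : ℕ) (ω : Ω) => T i ω - (if i = 0 then 0 else T (i - 1) ω)) μ
  law_gaps : ∀ i : ℕ,
    μ.map (fun ω => T i ω - (if i = 0 then 0 else T (i - 1) ω)) = expMeasure 1

/-- The input of the Poisson functional representation: arrival times of a rate-one Poisson
process and, independent of them, an i.i.d. sequence with law `Q`. -/
structure IsPoissonSource {Ω U : Type*} [MeasurableSpace Ω] [MeasurableSpace U]
    (μ : Measure Ω) (Q : Measure U) (T : ℕ → Ω → ℝ) (X : ℕ → Ω → U) : Prop where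
  arrivals : IsPoissonArrivals μ T
  measurable : ∀ i, Measurable (X i)
  indep : iIndepFun X μ
  law : ∀ i, μ.map (X i) = Q
  indep_arrivals : IndepFun (fun ω (i : ℕ) => T i ω) (fun ω (i : ℕ) => X i ω) μ

/-- The ratio `T_i / (dP/dQ)(U_i)`, equal to `∞` when the density vanishes and `T_i > 0`. -/
def pfrScore {Ω U : Type*} [MeasurableSpace U] (P Q : Measure U)
    (T : ℕ → Ω → ℝ) (X : ℕ → Ω → U) (i : ℕ) (ω : Ω) : ℝ≥0∞ :=
  ENNReal.ofReal (T i ω) / P.rnDeriv Q (X i ω)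

/-- Output `K` of the Poisson functional representation: the index minimizing `pfrScore`. The
sequences are indexed from `0`, and `K` counts from `1`. The minimizer exists and is unique almost
surely; on the exceptional null event the least minimizer, or `1` if there is none, is taken. -/
def pfrIndex {Ω U : Type*} [MeasurableSpace U] (P Q : Measure U)
    (T : ℕ → Ω → ℝ) (X : ℕ → Ω → U) (ω : Ω) : ℕ+ :=
  Nat.succPNat (sInf {k : ℕ | ∀ i : ℕ, pfrScore P Q T X k ω ≤ pfrScore P Q T X i ω})

/-- Average codeword length of order `t > 0`: `L(t) = 1 / t * log₂ E[2 ^ (t * l(C(K)))]`. -/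
def campbellCost {Ω : Type*} [MeasurableSpace Ω] (μ : Measure Ω) (K : Ω → ℕ+)
    (C : ℕ+ → List Bool) (t : ℝ) : EReal :=
  ((t⁻¹ : ℝ) : EReal) * log2E (∫⁻ ω, (2 : ℝ≥0∞) ^ (t * ((C (K ω)).length : ℝ)) ∂μ)

/-- Expected codeword length `E[l(C(K))]`. -/
def expectedLength {Ω : Type*} [MeasurableSpace Ω] (μ : Measure Ω) (K : Ω → ℕ+)
    (C : ℕ+ → List Bool) : ℝ≥0∞ :=
  ∫⁻ ω, ((C (K ω)).length : ℝ≥0∞) ∂μ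

/-- Shannon entropy in bits of a distribution on the positive integers. -/
def entropyBits (p : PMF ℕ+) : ℝ≥0∞ :=
  ∑' k, ENNReal.ofReal (Real.negMulLog (p k).toReal / Real.log 2)

/-- A binary code is prefix-free if no codeword is a prefix of the codeword of another symbol. -/
def IsPrefixFree (C : ℕ+ → List Bool) : Prop :=
  ∀ j k : ℕ+, C j <+: C k → j = k

/-- Universal code of the positive integers (Elias): a prefix-free binary code whose expected
length is at most a constant times `max(1, H(p))`, for all nonincreasing distributions `p`. -/
def IsUniversalCode (C : ℕ+ → List Bool) : Prop :=
  IsPrefixFree C ∧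
    ∃ c : ℝ≥0∞, c ≠ ∞ ∧ ∀ p : PMF ℕ+, Antitone (fun k => p k) →
      ∑' k, p k * ((C k).length : ℝ≥0∞) ≤ c * max 1 (entropyBits p)

/-- The length profile `log₂ k + (1 + ε) log₂ log₂ (k + 1)`. -/
def lengthProfile (ε : ℝ) (k : ℕ+) : ℝ :=
  Real.logb 2 (k : ℝ) + (1 + ε) * Real.logb 2 (Real.logb 2 ((k : ℝ) + 1))

/-- The additive constant `1 + log₂ (ln 2 / ε + 3 / 2)` in the codeword lengths. -/
def lengthConst (ε : ℝ) : ℝ := 1 + Real.logb 2 (Real.log 2 / ε + 3 / 2)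

/-- `c₂(ε) = 3 + ε + log₂ (ln 2 / ε + 3 / 2)`. -/
def c2 (ε : ℝ) : ℝ := 3 + ε + Real.logb 2 (Real.log 2 / ε + 3 / 2)

end

/-! Write r = dP/dQ and call T_i / r(U_i) the score of point i. The minimizing index satisfies E[K |
U_K] ≤ 1 + r(U_K), where U_K has law P. All that is needed of this is the inequality
`IsPoissonSource.lintegral_minimizer_le`, proved without conditional expectations or exact Poisson
laws. Memorylessness gives a Mecke formula: a sum over the points of the process becomes an integral
over (t, u), the remaining points keeping the original law. Let S(θ) be the probability that all
scores are at least θ. Applied to the minimal point, the formula gives ∫_{θ ≥ θ₀} S ≤ S(θ₀), hence ∫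
S ≤ 1 and ∫ θ S(θ) ≤ 1. The index of a point at time t counts the earlier arrivals; on the event
that all other scores are at least θ, this count has mean at most t S(θ), and t = θ r(u).

For concave f, tangents at 1 + r(U_K) then give E f(K) ≤ E_P f(1 + r), whence E log K ≤ D + 1 and E
K^γ ≤ 2^γ E_Q r^(1+γ) for 0 < γ < 1. Bound (b) follows with Jensen for log log(K+1). For (a), 2^(t
n_K) is at most a constant times K^t log(K+1)^(t(1+ε)), and Cauchy–Schwarz separates the two
factors. This doubles the exponents: hence the Rényi order 1 + 2t = (2-α)/α and the conditions 2t <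
1 and 2t(1+ε) ≤ 1, which are those on α and ε. For (c), the Campbell cost and the Rényi divergence
are cumulant generating functions divided by their argument, up to the change of base, and so tend
to means.

The code comes from Kraft's theorem and the bound ln 2/ε + 3/2 for the sum of 1/(k log(k+1)^(1+ε)).
It is universal because k p_k ≤ 1 for nonincreasing p. -/

/-- Insert `a` at position `k` of the sequence `x`. -/
def insertAt {α : Type*} (k : ℕ) (a : α) (x : ℕ → α) (i : ℕ) : α :=
  if i < k then x i else if i = k then a else x (i - 1)

/-- The increasing enumeration of the natural numbers different from `k`. -/
def skipIndex (k j : ℕ) : ℕ := if j < k then j else j + 1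

/-! ### Inserting a sample into an i.i.d. sequence. -/

section insertAt

variable {α : Type*}

lemma insertAt_self (k : ℕ) (a : α) (x : ℕ → α) : insertAt k a x k = a := by simp [insertAt]

lemma insertAt_skipIndex (k : ℕ) (a : α) (x : ℕ → α) (j : ℕ) :
    insertAt k a x (skipIndex k j) = x j := by
  unfold insertAt skipIndex
  grind

lemma skipIndex_injective (k : ℕ) : Function.Injective (skipIndex k) := by
  intro i j h
  unfold skipIndex at h
  grind

lemma exists_skipIndex_eq {k i : ℕ} (h : i ≠ k) : ∃ j, skipIndex k j = i := by
  unfold skipIndex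
  rcases lt_or_gt_of_ne h with h | h
  · exact ⟨i, by simp [h]⟩
  · exact ⟨i - 1, by grind⟩

lemma skipIndex_ne (k j : ℕ) : skipIndex k j ≠ k := by
  unfold skipIndex
  grind

lemma forall_insertAt_iff {k : ℕ} {p : ℕ → Prop} :
    (∀ i, p i) ↔ p k ∧ ∀ j, p (skipIndex k j) := by
  refine ⟨fun h => ⟨h k, fun j => h _⟩, fun ⟨h, h'⟩ i => ?_⟩
  by_cases hi : i = k
  · exact hi ▸ h
  · obtain ⟨j, rfl⟩ := exists_skipIndex_eq hi
    exact h' j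

@[fun_prop]
lemma measurable_insertAt [MeasurableSpace α] (k : ℕ) :
    Measurable (fun p : α × (ℕ → α) => insertAt k p.1 p.2) := by
  refine measurable_pi_lambda _ fun i => ?_
  unfold insertAt
  split_ifs <;> fun_prop

/-- Inserting an independent sample into an i.i.d. sequence gives an i.i.d. sequence. -/
lemma map_insertAt_infinitePi [MeasurableSpace α] (Q : Measure α) [IsProbabilityMeasure Q]
    (k : ℕ) :
    (Q.prod (Measure.infinitePi fun _ : ℕ => Q)).map (fun p => insertAt k p.1 p.2) =
      Measure.infinitePi fun _ : ℕ => Q := by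
  classical
  refine Measure.eq_infinitePi _ fun s t ht => ?_
  rw [Measure.map_apply (by fun_prop) (MeasurableSet.pi s.countable_toSet fun i _ => ht i)]
  -- A box splits into its constraint on coordinate `k`, void if `k ∉ s`, and a box on the other
  -- coordinates renumbered by `skipIndex`.
  set s' := s.preimage (skipIndex k) (skipIndex_injective k).injOn
  have : (fun p : α × (ℕ → α) => insertAt k p.1 p.2) ⁻¹' (Set.pi s t) =
      (if k ∈ s then t k else Set.univ) ×ˢ (Set.pi s' fun j => t (skipIndex k j)) := by
    ext p
    simp only [Set.mem_preimage, Set.mem_pi, Set.mem_prod]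
    rw [forall_insertAt_iff (k := k)]
    simp only [insertAt_self, insertAt_skipIndex]
    refine and_congr ?_ ?_
    · split_ifs with h <;> simp [h]
    · simp [s']
  rw [this, Measure.prod_prod, Measure.infinitePi_pi _ fun i _ => ht _]
  have h2 : ∏ j ∈ s', Q (t (skipIndex k j)) = ∏ i ∈ s, if i = k then 1 else Q (t i) := by
    rw [← Finset.prod_preimage (skipIndex k) s (skipIndex_injective k).injOn]
    · refine Finset.prod_congr rfl fun j _ => ?_
      rw [if_neg (skipIndex_ne k j)]
    · intro i _ hi
      have : i = k := by
        by_contra h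
        exact hi (exists_skipIndex_eq h)
      simp [this]
  rw [h2]
  by_cases h : k ∈ s
  · rw [if_pos h, ← Finset.mul_prod_erase s _ h, ← Finset.mul_prod_erase s _ h, if_pos rfl, one_mul]
    congr 1
    refine Finset.prod_congr rfl fun i hi => ?_
    rw [if_neg (Finset.ne_of_mem_erase hi)]
  · rw [if_neg h, measure_univ, one_mul]
    refine Finset.prod_congr rfl fun i hi => ?_
    rw [if_neg (by rintro rfl; exact h hi)]

end insertAt

/-! ### Memorylessness of exponential gaps. -/

section Exponential

lemma expMeasure_one_Iic_zero : expMeasure 1 (Set.Iic 0) = 0 := by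
  have h0 : expMeasure 1 {(0 : ℝ)} = 0 := by
    rw [expMeasure, gammaMeasure]
    exact (withDensity_absolutelyContinuous _ _) (by simp)
  have h1 : expMeasure 1 (Set.Iio 0) = 0 := by
    rw [expMeasure, gammaMeasure, withDensity_apply _ measurableSet_Iio]
    exact lintegral_gammaPDF_of_nonpos le_rfl
  rw [← Set.Iio_union_right]
  exact measure_union_null h1 h0

/-- Memorylessness of the exponential distribution. -/
lemma expMeasure_one_shift {a : ℝ} (ha : 0 ≤ a) {B : Set ℝ} (hB : MeasurableSet B) :
    expMeasure 1 ({y | y - a ∈ B} ∩ Set.Ioi a) = ENNReal.ofReal (Real.exp (-a)) * expMeasure 1 B := by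
  have hB' : MeasurableSet ({y | y - a ∈ B} ∩ Set.Ioi a) :=
    ((measurable_id.sub_const a) hB).inter measurableSet_Ioi
  have key : expMeasure 1 B = expMeasure 1 (B ∩ Set.Ioi 0) := by
    have h0 : expMeasure 1 (B \ Set.Ioi 0) = 0 :=
      measure_mono_null (fun x hx => by simpa using hx.2) expMeasure_one_Iic_zero
    rw [← measure_inter_add_sdiff B (measurableSet_Ioi (a := (0 : ℝ))), h0, add_zero]
  have hpdf : ∀ B, MeasurableSet B → expMeasure 1 B = ∫⁻ x, B.indicator (exponentialPDF 1) x := by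
    intro B hB
    rw [expMeasure, gammaMeasure, withDensity_apply _ hB, lintegral_indicator hB]
    rfl
  rw [key, hpdf _ hB', hpdf _ (hB.inter measurableSet_Ioi), ← lintegral_const_mul']
  · rw [← lintegral_add_right_eq_self _ a]
    refine lintegral_congr fun x => ?_
    classical
    simp only [Set.indicator_apply, Set.mem_inter_iff, Set.mem_ofPred_eq, Set.mem_Ioi,
      add_sub_cancel_right, lt_add_iff_pos_left]
    split_ifs with h
    · rw [exponentialPDF_of_nonneg (by linarith [h.2]), exponentialPDF_of_nonneg h.2.le,
        ← ENNReal.ofReal_mul (Real.exp_nonneg _)]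
      simp only [one_mul, ← Real.exp_add]
      congr 2
      ring
    · simp
  · exact ENNReal.ofReal_ne_top

instance : IsProbabilityMeasure (expMeasure 1) := isProbabilityMeasure_expMeasure one_pos

/-- Memorylessness in one coordinate of an i.i.d. exponential sequence. -/
lemma map_restrict_infinitePi_expMeasure {a : ℝ} (ha : 0 ≤ a) (k : ℕ) :
    ((Measure.infinitePi fun _ : ℕ => expMeasure 1).restrict {e | a < e k}).map
      (fun e => Function.update e k (e k - a)) =
      ENNReal.ofReal (Real.exp (-a)) • Measure.infinitePi fun _ : ℕ => expMeasure 1 := by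
  classical
  have hm : Measurable (fun e : ℕ → ℝ => Function.update e k (e k - a)) := by
    refine measurable_pi_lambda _ fun i => ?_
    by_cases h : i = k
    · subst h; simp only [Function.update_self]; fun_prop
    · simp only [Function.update_of_ne h]; fun_prop
  have hms : MeasurableSet {e : ℕ → ℝ | a < e k} :=
    measurableSet_lt measurable_const (measurable_pi_apply k)
  have hc : ENNReal.ofReal (Real.exp a) * ENNReal.ofReal (Real.exp (-a)) = 1 := by
    rw [← ENNReal.ofReal_mul (Real.exp_nonneg _), ← Real.exp_add]; simp
  -- Multiplying by exp a normalizes the left side, so that it can be identified by its values on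
  -- boxes.
  suffices h : ENNReal.ofReal (Real.exp a) •
      ((Measure.infinitePi fun _ : ℕ => expMeasure 1).restrict {e | a < e k}).map
      (fun e => Function.update e k (e k - a)) = Measure.infinitePi fun _ : ℕ => expMeasure 1 by
    conv_rhs => rw [← h, smul_smul, mul_comm, hc, one_smul]
  refine Measure.eq_infinitePi _ fun s t ht => ?_
  have hpi : MeasurableSet (Set.pi (s : Set ℕ) t) :=
    MeasurableSet.pi s.countable_toSet fun i _ => ht i
  rw [Measure.smul_apply, Measure.map_apply hm hpi, Measure.restrict_apply (hm hpi)]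
  set t' : ℕ → Set ℝ := fun i => if i = k then
    {y | y - a ∈ (if k ∈ s then t k else Set.univ)} ∩ Set.Ioi a else t i
  have hBm : MeasurableSet (if k ∈ s then t k else Set.univ) := by
    split_ifs
    · exact ht k
    · exact MeasurableSet.univ
  have hset : (fun e : ℕ → ℝ => Function.update e k (e k - a)) ⁻¹' (Set.pi s t) ∩ {e | a < e k} =
      Set.pi (insert k (s.erase k) : Finset ℕ) t' := by
    ext e
    simp only [Set.mem_inter_iff, Set.mem_preimage, Set.mem_pi, Finset.mem_coe,
      Set.mem_ofPred_eq, Finset.mem_insert, Finset.mem_erase, t']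
    constructor
    · rintro ⟨h1, h2⟩ i hi
      by_cases hik : i = k
      · subst hik
        rw [if_pos rfl]
        refine ⟨?_, h2⟩
        by_cases his : i ∈ s
        · simpa [his] using h1 i his
        · simp [his]
      · rw [if_neg hik]
        simpa [hik] using h1 i (by tauto)
    · intro h
      have hk := h k (Or.inl rfl)
      rw [if_pos rfl] at hk
      refine ⟨fun i hi => ?_, hk.2⟩
      by_cases hik : i = k
      · subst hik
        simpa [hi] using hk.1
      · simpa [hik] using h i (Or.inr ⟨hik, hi⟩)
  rw [hset, Measure.infinitePi_pi, Finset.prod_insert (by simp)]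
  · have h1 : t' k = {y | y - a ∈ (if k ∈ s then t k else Set.univ)} ∩ Set.Ioi a := by simp [t']
    rw [h1, expMeasure_one_shift ha hBm, smul_eq_mul, mul_assoc, ← mul_assoc, hc, one_mul]
    have h2 : ∏ i ∈ s.erase k, expMeasure 1 (t' i) = ∏ i ∈ s.erase k, expMeasure 1 (t i) :=
      Finset.prod_congr rfl fun i hi => by simp [t', Finset.ne_of_mem_erase hi]
    rw [h2]
    by_cases h : k ∈ s
    · rw [if_pos h, Finset.mul_prod_erase s (fun i => expMeasure 1 (t i)) h]
    · rw [if_neg h, measure_univ, one_mul, Finset.erase_eq_of_notMem h]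
  · intro i _
    by_cases hi : i = k
    · simp only [t', hi, if_true]
      exact ((measurable_id.sub_const a) hBm).inter measurableSet_Ioi
    · simp only [t', hi, if_false]
      exact ht i

end Exponential

/-! ### Mecke formula for the arrival times. -/

/-- The arrival times with the given gaps. -/
def arrivalSum (e : ℕ → ℝ) (i : ℕ) : ℝ := ∑ j ∈ Finset.range (i + 1), e j

/-- The arrival time before the one of index `k`, or `0` if there is none. -/
def prevArrival (T : ℕ → ℝ) (k : ℕ) : ℝ := if k = 0 then 0 else T (k - 1)

@[fun_prop]
lemma measurable_prevArrival (k : ℕ) : Measurable fun T => prevArrival T k := by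
  unfold prevArrival
  split_ifs <;> fun_prop

@[fun_prop]
lemma measurable_arrivalSum : Measurable arrivalSum := by
  refine measurable_pi_lambda _ fun i => ?_
  unfold arrivalSum
  fun_prop

lemma arrivalSum_eq_add (e : ℕ → ℝ) (k : ℕ) :
    arrivalSum e k = prevArrival (arrivalSum e) k + e k := by
  unfold prevArrival arrivalSum
  rw [Finset.sum_range_succ]
  split_ifs with h
  · simp [h]
  · rw [Nat.sub_add_cancel (Nat.one_le_iff_ne_zero.mpr h)]

lemma prevArrival_succ (T : ℕ → ℝ) (k : ℕ) : prevArrival T (k + 1) = T k := by simp [prevArrival]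

/-- Splitting a gap amounts to inserting an arrival. -/
lemma arrivalSum_insertAt_update (e : ℕ → ℝ) (k : ℕ) (a : ℝ) :
    arrivalSum (insertAt k a (Function.update e k (e k - a))) =
      insertAt k (prevArrival (arrivalSum e) k + a) (arrivalSum e) := by
  set e' := insertAt k a (Function.update e k (e k - a))
  have hlt : ∀ i < k, e' i = e i := fun i hi => by
    simp [e', insertAt, hi, hi.ne]
  have heq : e' k = a := insertAt_self _ _ _
  have hsucc : e' (k + 1) = e k - a := by simp [e', insertAt]
  have hgt : ∀ i, k < i → e' (i + 1) = e i := fun i hi => by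
    simp [e', insertAt, hi.ne', show ¬ i + 1 < k by omega, show i + 1 ≠ k by omega]
  have h1 : ∀ i < k, arrivalSum e' i = arrivalSum e i := fun i hi =>
    Finset.sum_congr rfl fun j hj => hlt j (by rw [Finset.mem_range] at hj; omega)
  have h2 : arrivalSum e' k = prevArrival (arrivalSum e) k + a := by
    rw [arrivalSum_eq_add, heq]
    congr 1
    unfold prevArrival
    split_ifs with h
    · rfl
    · exact h1 _ (by omega)
  have h3 : ∀ n, arrivalSum e' (k + 1 + n) = arrivalSum e (k + n) := by
    intro n
    induction n with
    | zero =>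
      rw [add_zero, arrivalSum_eq_add, prevArrival_succ, h2, hsucc, add_zero,
        arrivalSum_eq_add e k]
      ring
    | succ n ih =>
      rw [← add_assoc, arrivalSum_eq_add, prevArrival_succ, ih, ← add_assoc,
        arrivalSum_eq_add e (k + n + 1), prevArrival_succ,
        show k + 1 + n + 1 = (k + n + 1) + 1 by ring, hgt _ (by omega)]
  funext i
  rcases lt_trichotomy i k with h | h | h
  · rw [h1 i h]; simp [insertAt, h]
  · subst h; rw [h2, insertAt_self]
  · obtain ⟨n, rfl⟩ := Nat.exists_eq_add_of_le (Nat.succ_le_of_lt h)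
    rw [Nat.succ_eq_add_one, h3]
    unfold insertAt
    rw [if_neg (by omega), if_neg (by omega)]
    congr 1
    omega

lemma lintegral_expMeasure_one (f : ℝ → ℝ≥0∞) (hf : Measurable f) :
    ∫⁻ a, f a ∂(expMeasure 1) =
      ∫⁻ a, if 0 ≤ a then ENNReal.ofReal (Real.exp (-a)) * f a else 0 := by
  have : expMeasure 1 = volume.withDensity (exponentialPDF 1) := rfl
  have hm : Measurable (exponentialPDF 1) := (measurable_exponentialPDFReal 1).ennreal_ofReal
  rw [this, lintegral_withDensity_eq_lintegral_mul _ hm hf]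
  refine lintegral_congr fun a => ?_
  rw [Pi.mul_apply]
  split_ifs with h
  · rw [exponentialPDF_of_nonneg h, one_mul, one_mul]
  · rw [exponentialPDF_of_neg (not_le.mp h), zero_mul]

lemma measurable_update_sub (k : ℕ) :
    Measurable fun p : ℝ × (ℕ → ℝ) => Function.update p.2 k (p.2 k - p.1) := by
  refine measurable_pi_lambda _ fun i => ?_
  by_cases h : i = k
  · subst h; simp only [Function.update_self]; fun_prop
  · simp only [Function.update_of_ne h]; fun_prop

/-- Gap `k` is split off as an independent exponential `a`. By memorylessness its density exp(-a) is
absorbed by lengthening the next gap by `a`, so that `a` ranges over [0, `e k`) with Lebesgue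
measure. -/
lemma lintegral_infinitePi_expMeasure (k : ℕ) (F : (ℕ → ℝ) → ℝ≥0∞) (hF : Measurable F) :
    ∫⁻ e, F e ∂(Measure.infinitePi fun _ : ℕ => expMeasure 1) =
      ∫⁻ e, (∫⁻ a, if 0 ≤ a ∧ a < e k then
        F (insertAt k a (Function.update e k (e k - a))) else 0)
        ∂(Measure.infinitePi fun _ : ℕ => expMeasure 1) := by
  set ν := Measure.infinitePi fun _ : ℕ => expMeasure 1
  have hi := measurable_insertAt (α := ℝ) k
  have hu := measurable_update_sub k
  have hG : Measurable fun p : ℝ × (ℕ → ℝ) =>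
      F (insertAt k p.1 (Function.update p.2 k (p.2 k - p.1))) :=
    hF.comp (hi.comp (measurable_fst.prodMk hu))
  have hFi : Measurable fun p : ℝ × (ℕ → ℝ) => F (insertAt k p.1 p.2) := hF.comp hi
  rw [lintegral_lintegral_swap]
  · conv_lhs => rw [show ν = _ from (map_insertAt_infinitePi (expMeasure 1) k).symm]
    rw [lintegral_map hF hi, lintegral_prod _ hFi.aemeasurable,
      lintegral_expMeasure_one _ hFi.lintegral_prod_right']
    refine lintegral_congr fun a => ?_
    by_cases ha : 0 ≤ a
    · have hms : MeasurableSet {e : ℕ → ℝ | a < e k} :=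
        measurableSet_lt measurable_const (measurable_pi_apply k)
      simp only [ha, true_and]
      rw [← smul_eq_mul, ← lintegral_smul_measure, ← map_restrict_infinitePi_expMeasure ha k,
        lintegral_map (by fun_prop) (by fun_prop), ← lintegral_indicator hms]
      rfl
    · simp [ha]
  · refine (Measurable.ite ?_ (hG.comp measurable_swap) measurable_const).aemeasurable
    exact (measurableSet_le measurable_const measurable_snd).inter
      (measurableSet_lt measurable_snd ((measurable_pi_apply k).comp measurable_fst))

lemma IsPoissonArrivals.map_eq {Ω : Type*} [MeasurableSpace Ω] {μ : Measure Ω}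
    [IsProbabilityMeasure μ] {T : ℕ → Ω → ℝ} (h : IsPoissonArrivals μ T) :
    μ.map (fun ω i => T i ω) =
      (Measure.infinitePi fun _ : ℕ => expMeasure 1).map arrivalSum := by
  have hg : ∀ i, Measurable fun ω => T i ω - (if i = 0 then 0 else T (i - 1) ω) := by
    intro i
    have := h.measurable
    split_ifs <;> fun_prop
  have h1 := h.indep_gaps.map_fun_eq_infinitePi_map hg
  simp only [h.law_gaps] at h1
  rw [← h1, Measure.map_map measurable_arrivalSum (measurable_pi_lambda _ hg)]
  congr 1
  funext ω i
  simp only [Function.comp, arrivalSum]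
  induction i with
  | zero => simp
  | succ n ih => rw [Finset.sum_range_succ, ← ih]; simp

/-- Mecke formula for a Poisson process: removing an arrival. -/
lemma IsPoissonArrivals.lintegral_eq {Ω : Type*} [MeasurableSpace Ω] {μ : Measure Ω}
    [IsProbabilityMeasure μ] {T : ℕ → Ω → ℝ} (h : IsPoissonArrivals μ T) (k : ℕ)
    (F : (ℕ → ℝ) → ℝ≥0∞) (hF : Measurable F) :
    ∫⁻ x, F x ∂(μ.map fun ω i => T i ω) =
      ∫⁻ x, (∫⁻ t, if prevArrival x k ≤ t ∧ t < x k then F (insertAt k t x) else 0)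
        ∂(μ.map fun ω i => T i ω) := by
  have hm : Measurable fun p : (ℕ → ℝ) × ℝ =>
      if prevArrival p.1 k ≤ p.2 ∧ p.2 < p.1 k then F (insertAt k p.2 p.1) else 0 := by
    refine Measurable.ite ?_ ?_ measurable_const
    · exact (measurableSet_le ((measurable_prevArrival k).comp measurable_fst) measurable_snd).inter
        (measurableSet_lt measurable_snd ((measurable_pi_apply k).comp measurable_fst))
    · exact hF.comp ((measurable_insertAt k).comp measurable_swap)
  rw [h.map_eq, lintegral_map hF measurable_arrivalSum,
    lintegral_map hm.lintegral_prod_right' measurable_arrivalSum,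
    lintegral_infinitePi_expMeasure k (fun e => F (arrivalSum e)) (hF.comp measurable_arrivalSum)]
  refine lintegral_congr fun e => ?_
  -- Translation by the previous arrival turns the position inside the gap into a time.
  conv_rhs => rw [← lintegral_add_left_eq_self _ (prevArrival (arrivalSum e) k)]
  refine lintegral_congr fun a => ?_
  simp only [arrivalSum_insertAt_update, arrivalSum_eq_add e k, le_add_iff_nonneg_right,
    add_lt_add_iff_left]

/-! ### The partition of [0, ∞) by the arrivals. -/

section Intervals

variable {x : ℕ → ℝ} {t : ℝ}

lemma prevArrival_interval_unique (hx : Monotone x) {j k : ℕ}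
    (hj : prevArrival x j ≤ t ∧ t < x j) (hk : prevArrival x k ≤ t ∧ t < x k) : j = k := by
  have aux : ∀ {j k : ℕ}, t < x j → prevArrival x k ≤ t → k ≤ j := by
    intro j k h1 h2
    by_contra! h
    rw [prevArrival, if_neg (by omega)] at h2
    exact absurd (hx (show j ≤ k - 1 by omega)) (by linarith)
  exact le_antisymm (aux hk.2 hj.1) (aux hj.2 hk.1)

lemma prevArrival_nonneg (hx : Monotone x) (h0 : 0 ≤ x 0) (k : ℕ) : 0 ≤ prevArrival x k := by
  unfold prevArrival
  split_ifs
  · exact le_rfl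
  · exact h0.trans (hx (Nat.zero_le _))

/-- The intervals between consecutive arrivals are disjoint, so at most one term survives. Equality
in `tsum_interval_eq` also needs them to cover [0, ∞), that is, unbounded arrivals. -/
lemma tsum_interval_le (hx : Monotone x) (h0 : 0 ≤ x 0) {c : ℕ → ℝ≥0∞} {C : ℝ≥0∞}
    (hc : ∀ k, prevArrival x k ≤ t → t < x k → c k ≤ C) :
    ∑' k, (if prevArrival x k ≤ t ∧ t < x k then c k else 0) ≤ if 0 ≤ t then C else 0 := by
  by_cases h : ∃ k, prevArrival x k ≤ t ∧ t < x k
  · obtain ⟨k, hk⟩ := h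
    rw [tsum_eq_single k, if_pos hk, if_pos ((prevArrival_nonneg hx h0 k).trans hk.1)]
    · exact hc k hk.1 hk.2
    · intro j hj
      rw [if_neg fun h => hj (prevArrival_interval_unique hx h hk)]
  · push Not at h
    rw [ENNReal.tsum_eq_zero.mpr fun k => if_neg fun hk => absurd (h k hk.1) (not_le.mpr hk.2)]
    exact zero_le

lemma tsum_interval_eq (hx : Monotone x) (h0 : 0 ≤ x 0) (hu : ∃ k, t < x k) (c : ℝ≥0∞) :
    ∑' k, (if prevArrival x k ≤ t ∧ t < x k then c else 0) = if 0 ≤ t then c else 0 := by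
  classical
  refine le_antisymm (tsum_interval_le hx h0 fun _ _ _ => le_rfl) ?_
  split_ifs with ht
  · have hk : prevArrival x (Nat.find hu) ≤ t ∧ t < x (Nat.find hu) := by
      refine ⟨?_, Nat.find_spec hu⟩
      unfold prevArrival
      split_ifs with h
      · exact ht
      · exact not_lt.mp (Nat.find_min hu (by omega))
    refine le_trans ?_ (ENNReal.le_tsum (Nat.find hu))
    rw [if_pos hk]
  · exact zero_le

end Intervals

/-! ### Mecke formula for the marked process. -/

section Source

variable {Ω U : Type*} [MeasurableSpace Ω] [MeasurableSpace U] {μ : Measure Ω}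
  {Q : Measure U} {T : ℕ → Ω → ℝ} {X : ℕ → Ω → U}

lemma measurable_insertAt_pair {α : Type*} [MeasurableSpace α] (k : ℕ)
    (F : (ℕ → ℝ) × (ℕ → U) → ℝ≥0∞) (hF : Measurable F)
    {x : α → ℕ → ℝ} {y : α → ℕ → U} {u : α → U} {t : α → ℝ} (hx : Measurable x)
    (hy : Measurable y) (hu : Measurable u) (ht : Measurable t) :
    Measurable fun a => if prevArrival (x a) k ≤ t a ∧ t a < x a k then
      F (insertAt k (t a) (x a), insertAt k (u a) (y a)) else 0 := by
  refine Measurable.ite ?_ ?_ measurable_const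
  · exact (measurableSet_le ((measurable_prevArrival k).comp hx) ht).inter
      (measurableSet_lt ht ((measurable_pi_apply k).comp hx))
  · exact hF.comp (((measurable_insertAt k).comp (ht.prodMk hx)).prodMk
      ((measurable_insertAt k).comp (hu.prodMk hy)))

lemma IsPoissonSource.map_pair_eq [IsProbabilityMeasure μ] (h : IsPoissonSource μ Q T X) :
    μ.map (fun ω => ((fun i => T i ω), (fun i => X i ω))) =
      (μ.map fun ω i => T i ω).prod (Measure.infinitePi fun _ : ℕ => μ.map (X 0)) := by
  have hT : Measurable fun ω i => T i ω := measurable_pi_lambda _ h.arrivals.measurable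
  have hX : Measurable fun ω i => X i ω := measurable_pi_lambda _ h.measurable
  rw [(indepFun_iff_map_prod_eq_prod_map_map hT.aemeasurable hX.aemeasurable).mp h.indep_arrivals,
    h.indep.map_fun_eq_infinitePi_map h.measurable]
  simp only [h.law]

/-- Mecke formula for the input of the Poisson functional representation. -/
lemma IsPoissonSource.lintegral_eq [IsProbabilityMeasure μ] [IsProbabilityMeasure Q]
    (h : IsPoissonSource μ Q T X) (k : ℕ)
    (F : (ℕ → ℝ) × (ℕ → U) → ℝ≥0∞) (hF : Measurable F) :
    ∫⁻ ω, F ((fun i => T i ω), (fun i => X i ω)) ∂μ =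
      ∫⁻ u, (∫⁻ t, (∫⁻ ω, if prevArrival (fun i => T i ω) k ≤ t ∧ t < T k ω then
        F (insertAt k t (fun i => T i ω), insertAt k u (fun i => X i ω)) else 0 ∂μ)) ∂Q := by
  have hT : Measurable fun ω i => T i ω := measurable_pi_lambda _ h.arrivals.measurable
  have hX : Measurable fun ω i => X i ω := measurable_pi_lambda _ h.measurable
  have hmap := h.map_pair_eq
  simp only [h.law] at hmap
  set τ := μ.map fun ω i => T i ω with hτ
  have : IsProbabilityMeasure τ := Measure.isProbabilityMeasure_map hT.aemeasurable
  set κ := Measure.infinitePi fun _ : ℕ => Q with hκ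
  have hins : Measurable fun p : U × (ℕ → U) => insertAt k p.1 p.2 := measurable_insertAt k
  have hH : Measurable fun y => ∫⁻ x, F (x, y) ∂τ := hF.lintegral_prod_left'
  -- The mark is inserted first, then the arrival with the marks fixed; the two Tonelli swaps bring
  -- `t` outside the expectation.
  calc ∫⁻ ω, F ((fun i => T i ω), (fun i => X i ω)) ∂μ
      = ∫⁻ p, F p ∂(τ.prod κ) := by rw [← hmap, lintegral_map hF (hT.prodMk hX)]
    _ = ∫⁻ y, ∫⁻ x, F (x, y) ∂τ ∂κ := lintegral_prod_symm _ hF.aemeasurable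
    _ = ∫⁻ u, ∫⁻ y, ∫⁻ x, F (x, insertAt k u y) ∂τ ∂κ ∂Q := by
      conv_lhs => rw [hκ, ← map_insertAt_infinitePi Q k]
      rw [lintegral_map hH hins]
      exact lintegral_prod _ (hH.comp hins).aemeasurable
    _ = ∫⁻ u, ∫⁻ y, ∫⁻ x, (∫⁻ t, if prevArrival x k ≤ t ∧ t < x k then
        F (insertAt k t x, insertAt k u y) else 0) ∂τ ∂κ ∂Q := by
      refine lintegral_congr fun u => lintegral_congr fun y => ?_
      exact h.arrivals.lintegral_eq k _ (hF.comp (measurable_id.prodMk measurable_const))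
    _ = ∫⁻ u, ∫⁻ y, (∫⁻ t, ∫⁻ x, if prevArrival x k ≤ t ∧ t < x k then
        F (insertAt k t x, insertAt k u y) else 0 ∂τ) ∂κ ∂Q := by
      refine lintegral_congr fun u => lintegral_congr fun y => ?_
      exact lintegral_lintegral_swap (measurable_insertAt_pair k F hF measurable_fst
        measurable_const measurable_const measurable_snd).aemeasurable
    _ = ∫⁻ u, (∫⁻ t, ∫⁻ y, ∫⁻ x, if prevArrival x k ≤ t ∧ t < x k then
        F (insertAt k t x, insertAt k u y) else 0 ∂τ ∂κ) ∂Q := by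
      refine lintegral_congr fun u => ?_
      exact lintegral_lintegral_swap (Measurable.lintegral_prod_right'
        (measurable_insertAt_pair k F hF measurable_snd
        (measurable_fst.comp measurable_fst) measurable_const
        (measurable_snd.comp measurable_fst))).aemeasurable
    _ = _ := by
      refine lintegral_congr fun u => lintegral_congr fun t => ?_
      rw [← lintegral_prod_symm (μ := τ) (ν := κ) (fun z => if prevArrival z.1 k ≤ t ∧ t < z.1 k then
        F (insertAt k t z.1, insertAt k u z.2) else 0), ← hmap, lintegral_map]
      · exact measurable_insertAt_pair k F hF measurable_fst measurable_snd measurable_const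
          measurable_const
      · exact hT.prodMk hX
      · exact (measurable_insertAt_pair k F hF measurable_fst measurable_snd measurable_const
          measurable_const).aemeasurable

/-- The Mecke formula summed over the points of the process. -/
lemma IsPoissonSource.tsum_lintegral_eq [IsProbabilityMeasure μ] [IsProbabilityMeasure Q]
    (h : IsPoissonSource μ Q T X)
    (F : ℕ → (ℕ → ℝ) × (ℕ → U) → ℝ≥0∞) (hF : ∀ k, Measurable (F k)) :
    ∑' k, ∫⁻ ω, F k ((fun i => T i ω), (fun i => X i ω)) ∂μ =
      ∫⁻ u, (∫⁻ t, (∫⁻ ω, ∑' k, (if prevArrival (fun i => T i ω) k ≤ t ∧ t < T k ω then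
        F k (insertAt k t (fun i => T i ω), insertAt k u (fun i => X i ω)) else 0) ∂μ)) ∂Q := by
  have hT : Measurable fun ω i => T i ω := measurable_pi_lambda _ h.arrivals.measurable
  have hX : Measurable fun ω i => X i ω := measurable_pi_lambda _ h.measurable
  rw [tsum_congr fun k => h.lintegral_eq k _ (hF k), ← lintegral_tsum]
  · refine lintegral_congr fun u => ?_
    rw [← lintegral_tsum]
    · refine lintegral_congr fun t => ?_
      rw [← lintegral_tsum]
      exact fun k => (measurable_insertAt_pair k _ (hF k) hT hX measurable_const
        measurable_const).aemeasurable
    · intro k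
      exact (Measurable.lintegral_prod_right' (measurable_insertAt_pair k _ (hF k)
        (hT.comp measurable_snd) (hX.comp measurable_snd) measurable_const
        measurable_fst)).aemeasurable
  · intro k
    exact (Measurable.lintegral_prod_right' (Measurable.lintegral_prod_right'
      (measurable_insertAt_pair k _ (hF k)
        (hT.comp measurable_snd) (hX.comp measurable_snd) (measurable_fst.comp measurable_fst)
        (measurable_snd.comp measurable_fst)))).aemeasurable

lemma IsPoissonArrivals.ae_strictMono (h : IsPoissonArrivals μ T) :
    ∀ᵐ ω ∂μ, StrictMono (fun i => T i ω) ∧ 0 < T 0 ω := by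
  have hg : ∀ i, Measurable fun ω => T i ω - (if i = 0 then 0 else T (i - 1) ω) := by
    intro i
    have := h.measurable
    split_ifs <;> fun_prop
  have hpos : ∀ᵐ ω ∂μ, ∀ i : ℕ, 0 < T i ω - (if i = 0 then 0 else T (i - 1) ω) := by
    rw [ae_all_iff]
    intro i
    rw [ae_iff]
    have := expMeasure_one_Iic_zero
    rw [← h.law_gaps i, Measure.map_apply (hg i) measurableSet_Iic] at this
    convert this using 2
    ext ω
    simp
  filter_upwards [hpos] with ω hω
  refine ⟨strictMono_nat_of_lt_succ fun n => ?_, by simpa using hω 0⟩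
  simpa using hω (n + 1)

/-- The mean number of points of the process in a set is at most its intensity measure. -/
lemma IsPoissonSource.tsum_measure_le [IsProbabilityMeasure μ] [IsProbabilityMeasure Q]
    (h : IsPoissonSource μ Q T X) {B : Set (ℝ × U)} (hB : MeasurableSet B) :
    ∑' k, μ {ω | (T k ω, X k ω) ∈ B} ≤ ∫⁻ u, volume {t : ℝ | 0 ≤ t ∧ (t, u) ∈ B} ∂Q := by
  classical
  have hk : ∀ k, Measurable fun ω => (T k ω, X k ω) := fun k =>
    (h.arrivals.measurable k).prodMk (h.measurable k)
  have hF : ∀ k : ℕ, Measurable fun p : (ℕ → ℝ) × (ℕ → U) =>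
      B.indicator (1 : ℝ × U → ℝ≥0∞) (p.1 k, p.2 k) := fun k =>
    (measurable_one.indicator hB).comp (((measurable_pi_apply k).comp measurable_fst).prodMk
      ((measurable_pi_apply k).comp measurable_snd))
  have h1 : ∀ k, μ {ω | (T k ω, X k ω) ∈ B} =
      ∫⁻ ω, B.indicator (1 : ℝ × U → ℝ≥0∞) (T k ω, X k ω) ∂μ := fun k => by
    rw [show {ω | (T k ω, X k ω) ∈ B} = (fun ω => (T k ω, X k ω)) ⁻¹' B from rfl,
      ← lintegral_indicator_one (hk k hB)]
    rfl
  simp only [h1]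
  rw [h.tsum_lintegral_eq _ hF]
  refine lintegral_mono fun u => ?_
  have hS : MeasurableSet {t : ℝ | 0 ≤ t ∧ (t, u) ∈ B} :=
    measurableSet_Ici.inter ((measurable_id.prodMk measurable_const) hB)
  rw [← lintegral_indicator_one hS]
  refine lintegral_mono fun t => ?_
  calc _ ≤ ∫⁻ _, (if 0 ≤ t then B.indicator (1 : ℝ × U → ℝ≥0∞) (t, u) else 0) ∂μ := by
        refine lintegral_mono_ae ?_
        filter_upwards [h.arrivals.ae_strictMono] with ω hω
        refine tsum_interval_le hω.1.monotone hω.2.le fun k _ _ => ?_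
        simp [insertAt_self]
    _ ≤ _ := by
      rw [lintegral_const, measure_univ, mul_one, Set.indicator_apply]
      simp only [Set.indicator_apply, Pi.one_apply]
      split_ifs <;> simp_all

/-- The mean number of arrivals in [0, n] is finite, so by Borel–Cantelli only finitely many
arrivals are at most n. -/
lemma IsPoissonSource.ae_tendsto [IsProbabilityMeasure μ] [IsProbabilityMeasure Q]
    (h : IsPoissonSource μ Q T X) : ∀ᵐ ω ∂μ, ∀ t : ℝ, ∃ k, t < T k ω := by
  have h1 : ∀ n : ℕ, ∀ᵐ ω ∂μ, ∃ k, (n : ℝ) < T k ω := by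
    intro n
    have hB := h.tsum_measure_le (B := {p | p.1 ≤ (n : ℝ)})
      (measurableSet_le measurable_fst measurable_const)
    have hfin : ∑' k, μ {ω | T k ω ≤ n} ≠ ∞ := by
      refine ne_top_of_le_ne_top ?_ hB
      have : ∀ u : U, {t : ℝ | 0 ≤ t ∧ (t, u) ∈ {p : ℝ × U | p.1 ≤ (n : ℝ)}} = Set.Icc 0 (n : ℝ) :=
        fun u => by ext; simp
      simp only [this]
      simp
    filter_upwards [ae_eventually_notMem hfin] with ω hω
    obtain ⟨k, hk⟩ := hω.exists
    exact ⟨k, by simpa using hk⟩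
  filter_upwards [ae_all_iff.mpr h1] with ω hω t
  obtain ⟨n, hn⟩ := exists_nat_gt t
  obtain ⟨k, hk⟩ := hω n
  exact ⟨k, hn.trans hk⟩

end Source

/-! ### Scores and the probability that all of them exceed a level. -/

/-- The scores `T_i / r (X_i)` of a sequence of arrival times and marks. -/
noncomputable def scoreSeq {U : Type*} (r : U → ℝ≥0∞) (p : (ℕ → ℝ) × (ℕ → U)) (i : ℕ) : ℝ≥0∞ :=
  ENNReal.ofReal (p.1 i) / r (p.2 i)

lemma scoreSeq_insertAt_self {U : Type*} (r : U → ℝ≥0∞) (k : ℕ) (t : ℝ) (u : U) (x : ℕ → ℝ)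
    (y : ℕ → U) :
    scoreSeq r (insertAt k t x, insertAt k u y) k = ENNReal.ofReal t / r u := by
  simp [scoreSeq, insertAt_self]

lemma scoreSeq_insertAt_skipIndex {U : Type*} (r : U → ℝ≥0∞) (k : ℕ) (t : ℝ) (u : U)
    (x : ℕ → ℝ) (y : ℕ → U) (j : ℕ) :
    scoreSeq r (insertAt k t x, insertAt k u y) (skipIndex k j) = scoreSeq r (x, y) j := by
  simp [scoreSeq, insertAt_skipIndex]

/-- Change of variables from the arrival time to the score. -/
lemma lintegral_Ici_comp_div {c : ℝ≥0∞} (hc : c ≠ ∞) {φ : ℝ≥0∞ → ℝ≥0∞} (hm : Measurable φ)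
    (hφ : φ ∞ = 0) :
    ∫⁻ t in Set.Ici (0 : ℝ), φ (ENNReal.ofReal t / c) =
      c * ∫⁻ t in Set.Ici (0 : ℝ), φ (ENNReal.ofReal t) := by
  by_cases h0 : c = 0
  -- For `c = 0` the quotient is ∞ when `t > 0`, where `φ` vanishes; the point `t = 0`, where 0 / 0
  -- = 0, is a null set.
  · rw [h0, zero_mul, setLIntegral_congr Ioi_ae_eq_Ici.symm,
      setLIntegral_congr_fun (g := fun _ => 0) measurableSet_Ioi, lintegral_zero]
    intro t ht
    have : ENNReal.ofReal t / 0 = ∞ := ENNReal.div_zero (by simpa using ht)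
    simp only [this, hφ]
  · have hcr : 0 < c.toReal := ENNReal.toReal_pos h0 hc
    rw [← lintegral_indicator measurableSet_Ici, ← lintegral_indicator measurableSet_Ici]
    conv_lhs => rw [← Real.smul_map_volume_mul_left hcr.ne']
    rw [lintegral_smul_measure, abs_of_pos hcr, ENNReal.ofReal_toReal hc, smul_eq_mul,
      lintegral_map _ (by fun_prop)]
    · congr 1
      refine lintegral_congr fun t => ?_
      classical
      simp only [Set.indicator_apply, Set.mem_Ici, mul_nonneg_iff_of_pos_left hcr]
      rw [ENNReal.ofReal_mul hcr.le, ENNReal.ofReal_toReal hc, mul_comm, mul_div_assoc,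
        ENNReal.div_self h0 hc, mul_one]
    · exact Measurable.indicator (by fun_prop) measurableSet_Ici

/-- The probability that all scores are in relation `R` to `θ`. -/
noncomputable def survival {Ω U : Type*} [MeasurableSpace Ω] (μ : Measure Ω)
    (T : ℕ → Ω → ℝ) (X : ℕ → Ω → U) (r : U → ℝ≥0∞)
    (R : ℝ≥0∞ → ℝ≥0∞ → Prop) (θ : ℝ≥0∞) : ℝ≥0∞ :=
  μ {ω | ∀ i, R θ (scoreSeq r (fun i => T i ω, fun i => X i ω) i)}

lemma measurable_survival_le {Ω U : Type*} [MeasurableSpace Ω] (μ : Measure Ω)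
    (T : ℕ → Ω → ℝ) (X : ℕ → Ω → U) (r : U → ℝ≥0∞) : Measurable (survival μ T X r (· ≤ ·)) := by
  have : Antitone (survival μ T X r (· ≤ ·)) := fun a b hab =>
    measure_mono fun ω hω i => hab.trans (hω i)
  exact this.measurable

lemma measurable_survival_lt {Ω U : Type*} [MeasurableSpace Ω] (μ : Measure Ω)
    (T : ℕ → Ω → ℝ) (X : ℕ → Ω → U) (r : U → ℝ≥0∞) : Measurable (survival μ T X r (· < ·)) := by
  have : Antitone (survival μ T X r (· < ·)) := fun a b hab =>
    measure_mono fun ω hω i => hab.trans_lt (hω i)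
  exact this.measurable

section Scores

variable {Ω U : Type*} [MeasurableSpace Ω] [MeasurableSpace U] {μ : Measure Ω}
  {Q : Measure U} {T : ℕ → Ω → ℝ} {X : ℕ → Ω → U} {r : U → ℝ≥0∞}

@[fun_prop]
lemma measurable_scoreSeq (hr : Measurable r) (i : ℕ) : Measurable fun p => scoreSeq r p i := by
  unfold scoreSeq
  fun_prop

lemma measurableSet_forall_scoreSeq {R : ℝ≥0∞ → ℝ≥0∞ → Prop}
    (hR : MeasurableSet {p : ℝ≥0∞ × ℝ≥0∞ | R p.1 p.2}) (hr : Measurable r)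
    (hT : ∀ i, Measurable (T i)) (hX : ∀ i, Measurable (X i)) (θ : ℝ≥0∞) :
    MeasurableSet {ω | ∀ i, R θ (scoreSeq r (fun i => T i ω, fun i => X i ω) i)} := by
  have h : ∀ i, MeasurableSet {ω | R θ (scoreSeq r (fun i => T i ω, fun i => X i ω) i)} := fun i => by
    refine (measurable_const.prodMk ((measurable_scoreSeq hr i).comp
      ((measurable_pi_lambda _ hT).prodMk (measurable_pi_lambda _ hX)))) hR
  convert MeasurableSet.iInter h using 1
  ext; simp

open Classical in
/-- Sum over all points of a function of the score and the mark of the point, on the event that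
the score is in relation `R` to all the others, with weights given by the index. -/
lemma IsPoissonSource.tsum_score [IsProbabilityMeasure μ] [IsProbabilityMeasure Q]
    (h : IsPoissonSource μ Q T X) (hr : Measurable r) {R : ℝ≥0∞ → ℝ≥0∞ → Prop}
    (hR : MeasurableSet {p : ℝ≥0∞ × ℝ≥0∞ | R p.1 p.2}) (w : ℕ → ℝ≥0∞)
    {Φ : ℝ≥0∞ × U → ℝ≥0∞} (hΦ : Measurable Φ) :
    ∑' k, ∫⁻ ω, (if ∀ j, R (scoreSeq r (fun i => T i ω, fun i => X i ω) k)
        (scoreSeq r (fun i => T i ω, fun i => X i ω) (skipIndex k j)) then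
        w k * Φ (scoreSeq r (fun i => T i ω, fun i => X i ω) k, X k ω) else 0) ∂μ =
      ∫⁻ u, (∫⁻ t, Φ (ENNReal.ofReal t / r u, u) * (∫⁻ ω in
        {ω | ∀ i, R (ENNReal.ofReal t / r u) (scoreSeq r (fun i => T i ω, fun i => X i ω) i)},
          ∑' k, (if prevArrival (fun i => T i ω) k ≤ t ∧ t < T k ω then w k else 0) ∂μ)) ∂Q := by
  have hT : Measurable fun ω i => T i ω := measurable_pi_lambda _ h.arrivals.measurable
  have hX : Measurable fun ω i => X i ω := measurable_pi_lambda _ h.measurable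
  have hF : ∀ k, Measurable fun p : (ℕ → ℝ) × (ℕ → U) =>
      if ∀ j, R (scoreSeq r p k) (scoreSeq r p (skipIndex k j)) then
        w k * Φ (scoreSeq r p k, p.2 k) else 0 := by
    intro k
    refine Measurable.ite ?_ ?_ measurable_const
    · rw [Set.ofPred_forall]
      exact MeasurableSet.iInter fun j => ((measurable_scoreSeq hr k).prodMk
        (measurable_scoreSeq hr _)) hR
    · exact (hΦ.comp ((measurable_scoreSeq hr k).prodMk
        ((measurable_pi_apply k).comp measurable_snd))).const_mul _
  rw [h.tsum_lintegral_eq _ hF]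
  refine lintegral_congr fun u => lintegral_congr fun t => ?_
  have hms := measurableSet_forall_scoreSeq hR hr h.arrivals.measurable h.measurable
    (ENNReal.ofReal t / r u)
  rw [← lintegral_indicator hms, ← lintegral_const_mul]
  · refine lintegral_congr fun ω => ?_
    simp only [scoreSeq_insertAt_self, scoreSeq_insertAt_skipIndex, insertAt_self,
      Set.indicator_apply, Set.mem_ofPred_eq]
    split_ifs with hc
    · rw [← ENNReal.tsum_mul_left]
      refine tsum_congr fun k => ?_
      split_ifs
      · rw [mul_comm]
      · simp
    · simp
  · refine Measurable.indicator (Measurable.tsum fun k => ?_) hms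
    refine Measurable.ite ?_ measurable_const measurable_const
    exact (measurableSet_le ((measurable_prevArrival k).comp hT) measurable_const).inter
        (measurableSet_lt measurable_const (h.arrivals.measurable k))

-- With unit weights exactly one interval contains `t ≥ 0`, so the expectation left by the Mecke
-- formula is `survival`. Substituting θ = t / r(u) produces the factor `r u`.
open Classical in
lemma IsPoissonSource.tsum_score_one [IsProbabilityMeasure μ] [IsProbabilityMeasure Q]
    (h : IsPoissonSource μ Q T X) (hr : Measurable r) (hr' : ∀ᵐ u ∂Q, r u ≠ ∞)
    {R : ℝ≥0∞ → ℝ≥0∞ → Prop}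
    (hR : MeasurableSet {p : ℝ≥0∞ × ℝ≥0∞ | R p.1 p.2}) (hs : Measurable (survival μ T X r R))
    {Φ : ℝ≥0∞ × U → ℝ≥0∞} (hΦ : Measurable Φ) (htop : ∀ u, Φ (∞, u) = 0) :
    ∑' k, ∫⁻ ω, (if ∀ j, R (scoreSeq r (fun i => T i ω, fun i => X i ω) k)
        (scoreSeq r (fun i => T i ω, fun i => X i ω) (skipIndex k j)) then
        Φ (scoreSeq r (fun i => T i ω, fun i => X i ω) k, X k ω) else 0) ∂μ =
      ∫⁻ u, r u * (∫⁻ t in Set.Ici (0 : ℝ), Φ (ENNReal.ofReal t, u) *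
        survival μ T X r R (ENNReal.ofReal t)) ∂Q := by
  have := h.tsum_score hr hR (fun _ => 1) hΦ
  simp only [one_mul] at this
  rw [this]
  refine lintegral_congr_ae ?_
  filter_upwards [hr'] with u hu
  rw [← lintegral_Ici_comp_div hu (φ := fun θ => Φ (θ, u) * survival μ T X r R θ)
    (by fun_prop) (by simp [htop]), ← lintegral_indicator measurableSet_Ici]
  refine lintegral_congr fun t => ?_
  have hae : ∀ᵐ ω ∂μ, ∑' k, (if prevArrival (fun i => T i ω) k ≤ t ∧ t < T k ω then (1 : ℝ≥0∞)
      else 0) = if 0 ≤ t then 1 else 0 := by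
    filter_upwards [h.arrivals.ae_strictMono, h.ae_tendsto] with ω h1 h2
    exact tsum_interval_eq h1.1.monotone h1.2.le (h2 t) 1
  rw [lintegral_congr_ae (ae_restrict_of_ae hae), lintegral_const, Measure.restrict_apply_univ]
  simp only [Set.indicator_apply, Set.mem_Ici]
  split_ifs
  · rw [one_mul]; rfl
  · simp

open Classical in
/-- The mean number of points in `[0, c]`, on the event that all scores are at least `θ`. -/
lemma IsPoissonSource.lintegral_count_le [IsProbabilityMeasure μ] [IsProbabilityMeasure Q]
    (h : IsPoissonSource μ Q T X) (hr : Measurable r) (c : ℝ) (θ : ℝ≥0∞) :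
    ∫⁻ ω in {ω | ∀ i, θ ≤ scoreSeq r (fun i => T i ω, fun i => X i ω) i},
      ∑' k, (if T k ω ≤ c then 1 else 0) ∂μ ≤
      ENNReal.ofReal c * survival μ T X r (· ≤ ·) θ := by
  have hT : Measurable fun ω i => T i ω := measurable_pi_lambda _ h.arrivals.measurable
  have hX : Measurable fun ω i => X i ω := measurable_pi_lambda _ h.measurable
  have hle : MeasurableSet {p : ℝ≥0∞ × ℝ≥0∞ | p.1 ≤ p.2} := measurableSet_le'
  have hms := measurableSet_forall_scoreSeq hle hr h.arrivals.measurable h.measurable θ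
  have hF : ∀ k, Measurable fun p : (ℕ → ℝ) × (ℕ → U) =>
      if (∀ j, θ ≤ scoreSeq r p j) ∧ p.1 k ≤ c then (1 : ℝ≥0∞) else 0 := by
    intro k
    have h1 : MeasurableSet {p : (ℕ → ℝ) × (ℕ → U) | ∀ j, θ ≤ scoreSeq r p j} := by
      rw [Set.ofPred_forall]
      exact MeasurableSet.iInter fun j => measurableSet_le measurable_const
        (measurable_scoreSeq hr j)
    have h2 : MeasurableSet {p : (ℕ → ℝ) × (ℕ → U) | p.1 k ≤ c} :=
      measurableSet_le ((measurable_pi_apply k).comp measurable_fst) measurable_const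
    exact Measurable.ite (h1.inter h2) measurable_const measurable_const
  have h1 : ∫⁻ ω in {ω | ∀ i, θ ≤ scoreSeq r (fun i => T i ω, fun i => X i ω) i},
      ∑' k, (if T k ω ≤ c then 1 else 0) ∂μ = ∑' k, ∫⁻ ω,
        (if (∀ j, θ ≤ scoreSeq r (fun i => T i ω, fun i => X i ω) j) ∧ T k ω ≤ c
          then (1 : ℝ≥0∞) else 0) ∂μ := by
    have h2 : ∀ k, Measurable fun ω => if (∀ j, θ ≤ scoreSeq r (fun i => T i ω, fun i => X i ω) j) ∧
        T k ω ≤ c then (1 : ℝ≥0∞) else 0 := fun k => (hF k).comp (hT.prodMk hX)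
    rw [← lintegral_tsum fun k => (h2 k).aemeasurable, ← lintegral_indicator hms]
    refine lintegral_congr fun ω => ?_
    simp only [Set.indicator_apply, Set.mem_ofPred_eq]
    split_ifs with hc
    · simp [hc]
    · simp [hc]
  rw [h1, h.tsum_lintegral_eq _ hF]
  -- A second use of the Mecke formula: the condition on the score of the inserted point is dropped,
  -- which costs only an inequality.
  calc _ ≤ ∫⁻ _, (∫⁻ t, ∫⁻ ω in {ω | ∀ i, θ ≤ scoreSeq r (fun i => T i ω, fun i => X i ω) i},
        (Set.Icc 0 c).indicator 1 t ∂μ) ∂Q := by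
        refine lintegral_mono fun u => lintegral_mono fun t => ?_
        simp only
        rw [← lintegral_indicator hms]
        refine lintegral_mono_ae ?_
        filter_upwards [h.arrivals.ae_strictMono] with ω hω
        refine (tsum_interval_le (C := Set.indicator {ω | ∀ i, θ ≤ scoreSeq r
          (fun i => T i ω, fun i => X i ω) i} (fun _ => if t ≤ c then 1 else 0) ω)
            hω.1.monotone hω.2.le fun k _ _ => ?_).trans ?_
        · rw [forall_insertAt_iff (k := k)]
          simp only [scoreSeq_insertAt_skipIndex, insertAt_self, Set.indicator_apply,
            Set.mem_ofPred_eq]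
          split_ifs <;> simp_all
        · simp only [Set.indicator_apply, Set.mem_ofPred_eq, Set.mem_Icc, Pi.one_apply]
          split_ifs <;> simp_all
    _ = _ := by
      simp only [lintegral_const, Measure.restrict_apply_univ, measure_univ, mul_one]
      rw [lintegral_mul_const _ (measurable_one.indicator measurableSet_Icc),
        lintegral_indicator_one measurableSet_Icc, Real.volume_Icc, sub_zero]
      rfl

end Scores

/-! ### The minimizer, its index and its mark. -/

section Minimizer

variable {Ω U : Type*} [MeasurableSpace Ω] [MeasurableSpace U] {μ : Measure Ω}
  {Q : Measure U} {T : ℕ → Ω → ℝ} {X : ℕ → Ω → U} {r : U → ℝ≥0∞}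

open Classical in
lemma IsPoissonSource.measurable_scoreTerm (h : IsPoissonSource μ Q T X) (hr : Measurable r)
    {R : ℝ≥0∞ → ℝ≥0∞ → Prop} (hR : MeasurableSet {p : ℝ≥0∞ × ℝ≥0∞ | R p.1 p.2}) (c : ℝ≥0∞)
    {Φ : ℝ≥0∞ × U → ℝ≥0∞} (hΦ : Measurable Φ) (k : ℕ) :
    Measurable fun ω => if ∀ j, R (scoreSeq r (fun i => T i ω, fun i => X i ω) k)
        (scoreSeq r (fun i => T i ω, fun i => X i ω) (skipIndex k j)) then
        c * Φ (scoreSeq r (fun i => T i ω, fun i => X i ω) k, X k ω) else 0 := by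
  have hTX : Measurable fun ω => ((fun i => T i ω), (fun i => X i ω)) :=
    (measurable_pi_lambda _ h.arrivals.measurable).prodMk (measurable_pi_lambda _ h.measurable)
  have hs : ∀ k, Measurable fun ω => scoreSeq r (fun i => T i ω, fun i => X i ω) k := fun k =>
    (measurable_scoreSeq hr k).comp hTX
  refine Measurable.ite ?_ ?_ measurable_const
  · rw [Set.ofPred_forall]
    exact MeasurableSet.iInter fun j => ((hs k).prodMk (hs _)) hR
  · exact (hΦ.comp ((hs k).prodMk (h.measurable k))).const_mul _

/-- By the Mecke formula and E_Q r = 1, the left side is the mean number of strict minimizers with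
finite score at least `θ₀`. There is at most one, and its presence forces all scores to be at least
`θ₀`. This replaces the computation S(θ) = exp(-θ). -/
lemma IsPoissonSource.lintegral_survival_lt_le [IsProbabilityMeasure μ] [IsProbabilityMeasure Q]
    (h : IsPoissonSource μ Q T X) (hr : Measurable r) (hr1 : ∫⁻ u, r u ∂Q = 1) (θ₀ : ℝ≥0∞) :
    ∫⁻ t in Set.Ici (0 : ℝ), (if θ₀ ≤ ENNReal.ofReal t then
      survival μ T X r (· < ·) (ENNReal.ofReal t) else 0) ≤ survival μ T X r (· ≤ ·) θ₀ := by
  classical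
  have hr' : ∀ᵐ u ∂Q, r u ≠ ∞ := (ae_lt_top hr (by simp [hr1])).mono fun u hu => hu.ne
  have hlt : MeasurableSet {p : ℝ≥0∞ × ℝ≥0∞ | p.1 < p.2} := measurableSet_lt'
  have hΦ : Measurable fun p : ℝ≥0∞ × U => if θ₀ ≤ p.1 ∧ p.1 ≠ ∞ then (1 : ℝ≥0∞) else 0 := by
    refine Measurable.ite ?_ measurable_const measurable_const
    exact (measurableSet_le measurable_const measurable_fst).inter
      (measurable_fst (measurableSet_singleton ∞).compl)
  have key := h.tsum_score_one (R := (· < ·)) hr hr' hlt (measurable_survival_lt μ T X r) hΦ (by simp)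
  refine (le_of_eq (Eq.trans ?_ key.symm)).trans ?_
  · trans ∫⁻ u, r u * (∫⁻ t in Set.Ici (0 : ℝ), (if θ₀ ≤ ENNReal.ofReal t then
      survival μ T X r (· < ·) (ENNReal.ofReal t) else 0)) ∂Q
    · rw [lintegral_mul_const _ hr, hr1, one_mul]
    · refine lintegral_congr fun u => congrArg (r u * ·) (lintegral_congr fun t => ?_)
      simp
  rw [← lintegral_tsum]
  · unfold survival
    rw [← lintegral_indicator_one (measurableSet_forall_scoreSeq measurableSet_le' hr
      h.arrivals.measurable h.measurable θ₀)]
    refine lintegral_mono fun ω => ?_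
    set s := scoreSeq r (fun i => T i ω, fun i => X i ω) with hs
    by_cases hk : ∃ k, (∀ j, s k < s (skipIndex k j)) ∧ θ₀ ≤ s k
    · obtain ⟨k, hk, hk'⟩ := hk
      have hmin : ∀ i, i ≠ k → s k < s i := fun i hi => by
        obtain ⟨j, rfl⟩ := exists_skipIndex_eq hi
        exact hk j
      rw [tsum_eq_single k]
      · rw [Set.indicator_of_mem]
        · simp only [Pi.one_apply]
          split_ifs <;> simp
        · intro i
          by_cases hi : i = k
          · exact hi ▸ hk'
          · exact hk'.trans (hmin i hi).le
      · intro i hi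
        refine if_neg fun hc => ?_
        obtain ⟨j, rfl⟩ := exists_skipIndex_eq hi.symm
        exact lt_asymm (hmin i hi) (hc j)
    · rw [ENNReal.tsum_eq_zero.mpr]
      · exact zero_le
      · intro k
        by_cases hc : ∀ j, s k < s (skipIndex k j)
        · rw [if_pos hc, if_neg fun h' => hk ⟨k, hc, h'.1⟩]
        · rw [if_neg hc]
  · intro k
    simpa only [one_mul] using (h.measurable_scoreTerm hr hlt 1 hΦ k).aemeasurable

/-- There are no ties, for almost all values of the score. -/
lemma IsPoissonSource.survival_lt_ae_eq [IsProbabilityMeasure μ]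
    (h : IsPoissonSource μ Q T X) (hr : Measurable r) :
    ∀ᵐ t ∂(volume.restrict (Set.Ici (0 : ℝ))),
      survival μ T X r (· < ·) (ENNReal.ofReal t) =
        survival μ T X r (· ≤ ·) (ENNReal.ofReal t) := by
  have hTX : Measurable fun ω => ((fun i => T i ω), (fun i => X i ω)) :=
    (measurable_pi_lambda _ h.arrivals.measurable).prodMk (measurable_pi_lambda _ h.measurable)
  have hs : ∀ k, Measurable fun ω => scoreSeq r (fun i => T i ω, fun i => X i ω) k := fun k =>
    (measurable_scoreSeq hr k).comp hTX
  -- Each score has only countably many atoms; off them, a tie with the level has probability zero.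
  have hc : (⋃ k, {θ : ℝ≥0∞ | 0 < μ {ω | scoreSeq r (fun i => T i ω, fun i => X i ω) k = θ}}).Countable :=
    Set.countable_iUnion fun k => Measure.countable_meas_level_set_pos (hs k)
  have hc' : (ENNReal.toReal '' ⋃ k,
      {θ : ℝ≥0∞ | 0 < μ {ω | scoreSeq r (fun i => T i ω, fun i => X i ω) k = θ}}).Countable :=
    hc.image _
  rw [ae_restrict_iff' measurableSet_Ici]
  filter_upwards [(hc'.ae_notMem volume : ∀ᵐ t, t ∉ _)] with t ht ht0
  refine le_antisymm (measure_mono fun ω hω i => (hω i).le) ?_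
  have hnull : ∀ k, μ {ω | scoreSeq r (fun i => T i ω, fun i => X i ω) k = ENNReal.ofReal t} = 0 := by
    intro k
    by_contra hne
    exact ht ⟨ENNReal.ofReal t, Set.mem_iUnion.mpr ⟨k, pos_iff_ne_zero.mpr hne⟩,
      ENNReal.toReal_ofReal ht0⟩
  refine measure_mono_ae ?_
  have : ∀ᵐ ω ∂μ, ∀ k, scoreSeq r (fun i => T i ω, fun i => X i ω) k ≠ ENNReal.ofReal t := by
    rw [ae_all_iff]
    intro k
    rw [ae_iff]
    simpa using hnull k
  filter_upwards [this] with ω hω hle i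
  exact lt_of_le_of_ne (hle i) (hω i).symm

lemma IsPoissonSource.lintegral_survival_tail_le [IsProbabilityMeasure μ] [IsProbabilityMeasure Q]
    (h : IsPoissonSource μ Q T X) (hr : Measurable r) (hr1 : ∫⁻ u, r u ∂Q = 1) (θ₀ : ℝ≥0∞) :
    ∫⁻ t in Set.Ici (0 : ℝ), (if θ₀ ≤ ENNReal.ofReal t then
      survival μ T X r (· ≤ ·) (ENNReal.ofReal t) else 0) ≤ survival μ T X r (· ≤ ·) θ₀ := by
  refine le_trans (le_of_eq ?_) (h.lintegral_survival_lt_le hr hr1 θ₀)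
  refine lintegral_congr_ae ?_
  filter_upwards [h.survival_lt_ae_eq hr] with t ht
  rw [ht]

lemma IsPoissonSource.lintegral_survival_le_one [IsProbabilityMeasure μ] [IsProbabilityMeasure Q]
    (h : IsPoissonSource μ Q T X) (hr : Measurable r) (hr1 : ∫⁻ u, r u ∂Q = 1) :
    ∫⁻ t in Set.Ici (0 : ℝ), survival μ T X r (· ≤ ·) (ENNReal.ofReal t) ≤ 1 := by
  have := h.lintegral_survival_tail_le hr hr1 0
  simp only [zero_le, if_true] at this
  exact this.trans prob_le_one

/-- Layer cake: θ is the integral of 1 over s ≤ θ. After the swap, the inner integral is a tail of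
S, at most S(s), and ∫ S ≤ 1. -/
lemma IsPoissonSource.lintegral_mul_survival_le_one [IsProbabilityMeasure μ]
    [IsProbabilityMeasure Q]
    (h : IsPoissonSource μ Q T X) (hr : Measurable r) (hr1 : ∫⁻ u, r u ∂Q = 1) :
    ∫⁻ t in Set.Ici (0 : ℝ), ENNReal.ofReal t *
      survival μ T X r (· ≤ ·) (ENNReal.ofReal t) ≤ 1 := by
  have hS := measurable_survival_le μ T X r
  calc _ = ∫⁻ t in Set.Ici (0 : ℝ), (∫⁻ s in Set.Ici (0 : ℝ),
        if ENNReal.ofReal s ≤ ENNReal.ofReal t then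
          survival μ T X r (· ≤ ·) (ENNReal.ofReal t) else 0) := by
        refine setLIntegral_congr_fun measurableSet_Ici fun t (ht : 0 ≤ t) => ?_
        simp only [ENNReal.ofReal_le_ofReal_iff ht]
        have : ∀ s, (if s ≤ t then survival μ T X r (· ≤ ·) (ENNReal.ofReal t) else 0) =
            (Set.Iic t).indicator (fun _ => survival μ T X r (· ≤ ·) (ENNReal.ofReal t)) s :=
          fun s => by simp [Set.indicator_apply]
        simp only [this]
        rw [lintegral_indicator measurableSet_Iic, lintegral_const,
          Measure.restrict_restrict measurableSet_Iic, Measure.restrict_apply_univ, Set.inter_comm,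
          Set.Ici_inter_Iic, Real.volume_Icc, sub_zero, mul_comm]
    _ = ∫⁻ s in Set.Ici (0 : ℝ), (∫⁻ t in Set.Ici (0 : ℝ),
        if ENNReal.ofReal s ≤ ENNReal.ofReal t then
          survival μ T X r (· ≤ ·) (ENNReal.ofReal t) else 0) := by
        refine lintegral_lintegral_swap (Measurable.ite ?_ ?_ measurable_const).aemeasurable
        · exact measurableSet_le (by fun_prop) (by fun_prop)
        · exact hS.comp (by fun_prop)
    _ ≤ ∫⁻ s in Set.Ici (0 : ℝ), survival μ T X r (· ≤ ·) (ENNReal.ofReal s) :=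
        lintegral_mono fun s => h.lintegral_survival_tail_le hr hr1 _
    _ ≤ 1 := h.lintegral_survival_le_one hr hr1

-- Summing over all minimizers makes uniqueness unnecessary. Infinite scores are given weight zero,
-- as the change of variables requires.
open Classical in
lemma IsPoissonSource.tsum_minimizer_le [IsProbabilityMeasure μ] [IsProbabilityMeasure Q]
    (h : IsPoissonSource μ Q T X) (hr : Measurable r) (hr1 : ∫⁻ u, r u ∂Q = 1)
    {g : U → ℝ≥0∞} (hg : Measurable g) :
    ∑' k, ∫⁻ ω, (if ∀ j, scoreSeq r (fun i => T i ω, fun i => X i ω) k ≤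
        scoreSeq r (fun i => T i ω, fun i => X i ω) (skipIndex k j) then
        (if scoreSeq r (fun i => T i ω, fun i => X i ω) k = ∞ then 0 else g (X k ω)) else 0) ∂μ ≤
      ∫⁻ u, r u * g u ∂Q := by
  have hr' : ∀ᵐ u ∂Q, r u ≠ ∞ := (ae_lt_top hr (by simp [hr1])).mono fun u hu => hu.ne
  have hΦ : Measurable fun p : ℝ≥0∞ × U => if p.1 = ∞ then 0 else g p.2 :=
    Measurable.ite (measurable_fst (measurableSet_singleton ∞)) measurable_const
      (hg.comp measurable_snd)
  rw [h.tsum_score_one hr hr' measurableSet_le' (measurable_survival_le μ T X r) hΦ (by simp)]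
  refine lintegral_mono fun u => mul_le_mul_right ?_ _
  simp only [ENNReal.ofReal_ne_top, if_false]
  have hS := measurable_survival_le μ T X r
  rw [lintegral_const_mul _ (by fun_prop)]
  exact (mul_le_mul_right (h.lintegral_survival_le_one hr hr1) _).trans (mul_one _).le

-- The zero-based index of a point at time `t` is at most the number of other arrivals up to `t`, of
-- mean at most t S(θ) on the event that their scores are at least θ. As t = θ r(u), a second factor
-- `r u` appears, and ∫ θ S(θ) ≤ 1 does the rest.
open Classical in
lemma IsPoissonSource.tsum_index_mul_minimizer_le [IsProbabilityMeasure μ]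
    [IsProbabilityMeasure Q]
    (h : IsPoissonSource μ Q T X) (hr : Measurable r) (hr1 : ∫⁻ u, r u ∂Q = 1)
    {g : U → ℝ≥0∞} (hg : Measurable g) :
    ∑' k : ℕ, ∫⁻ ω, (if ∀ j, scoreSeq r (fun i => T i ω, fun i => X i ω) k ≤
        scoreSeq r (fun i => T i ω, fun i => X i ω) (skipIndex k j) then
        k * (if scoreSeq r (fun i => T i ω, fun i => X i ω) k = ∞ then 0 else g (X k ω)) else 0) ∂μ ≤
      ∫⁻ u, r u * (r u * g u) ∂Q := by
  have hr' : ∀ᵐ u ∂Q, r u ≠ ∞ := (ae_lt_top hr (by simp [hr1])).mono fun u hu => hu.ne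
  have hΦ : Measurable fun p : ℝ≥0∞ × U => if p.1 = ∞ then 0 else g p.2 :=
    Measurable.ite (measurable_fst (measurableSet_singleton ∞)) measurable_const
      (hg.comp measurable_snd)
  have hS := measurable_survival_le μ T X r
  rw [h.tsum_score hr measurableSet_le' (fun k => (k : ℝ≥0∞)) hΦ]
  refine lintegral_mono_ae ?_
  filter_upwards [hr'] with u hu
  set φ : ℝ≥0∞ → ℝ≥0∞ := fun θ => (if θ = ∞ then 0 else g u) *
    ((r u * θ) * survival μ T X r (· ≤ ·) θ) with hφ
  have hφm : Measurable φ := by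
    refine Measurable.mul ?_ (by fun_prop)
    exact Measurable.ite (measurableSet_singleton ∞) measurable_const measurable_const
  calc _ ≤ ∫⁻ t in Set.Ici (0 : ℝ), φ (ENNReal.ofReal t / r u) := by
        rw [← lintegral_indicator measurableSet_Ici]
        refine lintegral_mono fun t => ?_
        have hae : ∀ᵐ ω ∂μ, ∑' k : ℕ, (if prevArrival (fun i => T i ω) k ≤ t ∧ t < T k ω then
            (k : ℝ≥0∞) else 0) ≤ if 0 ≤ t then ∑' k, (if T k ω ≤ t then 1 else 0) else 0 := by
          filter_upwards [h.arrivals.ae_strictMono] with ω hω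
          refine tsum_interval_le hω.1.monotone hω.2.le fun k hk _ => ?_
          calc (k : ℝ≥0∞) = ∑ j ∈ Finset.range k, (if T j ω ≤ t then 1 else 0) := by
                rw [Finset.sum_congr rfl (g := fun _ => (1 : ℝ≥0∞))]
                · simp
                · intro j hj
                  rw [Finset.mem_range] at hj
                  refine if_pos (le_trans ?_ hk)
                  rw [prevArrival, if_neg (by omega)]
                  exact hω.1.monotone (by omega)
            _ ≤ _ := ENNReal.sum_le_tsum _
        by_cases ht : 0 ≤ t
        · rw [Set.indicator_of_mem (by exact ht)]
          simp only [ht, if_true] at hae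
          have h2 := (lintegral_mono_ae (ae_restrict_of_ae (s := {ω | ∀ i, ENNReal.ofReal t / r u ≤
            scoreSeq r (fun i => T i ω, fun i => X i ω) i}) hae)).trans
            (h.lintegral_count_le hr t (ENNReal.ofReal t / r u))
          refine (mul_le_mul_right h2 _).trans (le_of_eq ?_)
          simp only [hφ]
          by_cases h0 : ENNReal.ofReal t / r u = ∞
          · simp [h0]
          · congr 2
            refine (ENNReal.mul_div_cancel' (fun h' => ?_) (fun h' => absurd h' hu)).symm
            by_contra hne
            exact h0 (by rw [h', ENNReal.div_zero hne])
        · simp only [ht, if_false] at hae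
          rw [Set.indicator_of_notMem (by exact ht), nonpos_iff_eq_zero, mul_eq_zero]
          right
          rw [lintegral_congr_ae (g := fun _ => 0)]
          · simp
          · exact (ae_restrict_of_ae hae).mono fun ω hω => le_antisymm hω zero_le
    _ = r u * ∫⁻ t in Set.Ici (0 : ℝ), φ (ENNReal.ofReal t) :=
        lintegral_Ici_comp_div hu hφm (by simp [hφ])
    _ = r u * (r u * g u * ∫⁻ t in Set.Ici (0 : ℝ), ENNReal.ofReal t *
          survival μ T X r (· ≤ ·) (ENNReal.ofReal t)) := by
        congr 1
        rw [← lintegral_const_mul _ (by fun_prop)]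
        refine lintegral_congr fun t => ?_
        simp only [hφ, ENNReal.ofReal_ne_top, if_false]
        ring
    _ ≤ r u * (r u * g u * 1) := by
        gcongr
        exact h.lintegral_mul_survival_le_one hr hr1
    _ = _ := by rw [mul_one]

/-- Almost surely, the score has a minimizer, at which it is finite. -/
lemma IsPoissonSource.ae_exists_minimizer [IsProbabilityMeasure μ] [IsProbabilityMeasure Q]
    (h : IsPoissonSource μ Q T X) (hr : Measurable r) (hr1 : ∫⁻ u, r u ∂Q = 1) :
    ∀ᵐ ω ∂μ, (∃ k, ∀ i, scoreSeq r (fun i => T i ω, fun i => X i ω) k ≤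
      scoreSeq r (fun i => T i ω, fun i => X i ω) i) ∧
      ∃ k, scoreSeq r (fun i => T i ω, fun i => X i ω) k ≠ ∞ := by
  have hr' : ∀ᵐ u ∂Q, r u ≠ ∞ := (ae_lt_top hr (by simp [hr1])).mono fun u hu => hu.ne
  -- The points with score below `n` have mean number at most `n` E_Q r = `n`, so almost surely they
  -- are finite in number.
  have h1 : ∀ n : ℕ, ∀ᵐ ω ∂μ, {k | scoreSeq r (fun i => T i ω, fun i => X i ω) k < n}.Finite := by
    intro n
    have hB := h.tsum_measure_le (B := {p | ENNReal.ofReal p.1 / r p.2 < n})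
      (measurableSet_lt (by fun_prop) measurable_const)
    refine ae_finite_setOfPred_mem (ne_top_of_le_ne_top ?_ hB)
    refine ne_top_of_le_ne_top (b := ∫⁻ u, n * r u ∂Q) ?_ (lintegral_mono_ae ?_)
    · rw [lintegral_const_mul _ hr, hr1]
      simp
    · filter_upwards [hr'] with u hu
      calc _ ≤ volume (Set.Icc 0 ((n : ℝ≥0∞) * r u).toReal) := by
            refine measure_mono fun t ⟨ht, ht'⟩ => ⟨ht, ?_⟩
            have h3 : ENNReal.ofReal t / r u < n := ht'
            have h2 : ENNReal.ofReal t ≤ n * r u := by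
              by_cases h0 : r u = 0
              · by_contra! h4
                rw [h0, mul_zero] at h4
                rw [h0, ENNReal.div_zero h4.ne'] at h3
                exact absurd h3 (by simp)
              · exact (ENNReal.div_le_iff h0 hu).mp h3.le
            rw [← ENNReal.toReal_ofReal ht]
            exact ENNReal.toReal_mono (ENNReal.mul_ne_top (by simp) hu) h2
        _ = _ := by
            rw [Real.volume_Icc, sub_zero, ENNReal.ofReal_toReal (ENNReal.mul_ne_top (by simp) hu)]
  have hZ : MeasurableSet {u | r u = 0} := hr (measurableSet_singleton 0)
  -- As E_Q r = 1, `r` is not almost surely 0, so by independence some mark has positive density and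
  -- hence a finite score.
  have h2 : ∀ᵐ ω ∂μ, ∃ k, r (X k ω) ≠ 0 := by
    have hq : Q {u | r u = 0} < 1 := by
      refine lt_of_le_of_ne prob_le_one fun h1 => ?_
      have : ∀ᵐ u ∂Q, r u = 0 := (prob_compl_eq_zero_iff hZ).mpr h1
      rw [lintegral_congr_ae this] at hr1
      simp at hr1
    rw [ae_iff]
    have hle : ∀ n : ℕ, μ {ω | ¬ ∃ k, r (X k ω) ≠ 0} ≤ Q {u | r u = 0} ^ n := by
      intro n
      have := h.indep.measure_inter_preimage_eq_mul (Finset.range n)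
        (sets := fun _ => {u | r u = 0}) (fun _ _ => hZ)
      have h3 : ∀ i, μ (X i ⁻¹' {u | r u = 0}) = Q {u | r u = 0} := fun i => by
        rw [← h.law i, Measure.map_apply (h.measurable i) hZ]
      simp only [h3, Finset.prod_const, Finset.card_range] at this
      rw [← this]
      refine measure_mono fun ω hω => ?_
      simp only [ne_eq, not_exists, not_not, Set.mem_ofPred_eq] at hω
      simp [hω]
    exact le_antisymm (ge_of_tendsto' (ENNReal.tendsto_pow_atTop_nhds_zero_of_lt_one hq) hle)
      zero_le
  filter_upwards [ae_all_iff.mpr h1, h2] with ω h1 h2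
  obtain ⟨k, hk⟩ := h2
  have hfin : scoreSeq r (fun i => T i ω, fun i => X i ω) k ≠ ∞ :=
    ENNReal.div_ne_top ENNReal.ofReal_ne_top hk
  refine ⟨?_, k, hfin⟩
  obtain ⟨n, hn⟩ := ENNReal.exists_nat_gt hfin
  obtain ⟨m, hm, hm'⟩ := Set.exists_min_image _ (scoreSeq r (fun i => T i ω, fun i => X i ω))
    (h1 n) ⟨k, hn⟩
  refine ⟨m, fun i => ?_⟩
  by_cases hi : scoreSeq r (fun i => T i ω, fun i => X i ω) i < n
  · exact hm' i hi
  · exact (lt_of_lt_of_le hm (not_lt.mp hi)).le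

/-- Joint moments of the index of a minimizer and of its mark. -/
lemma IsPoissonSource.lintegral_minimizer_le [IsProbabilityMeasure μ] [IsProbabilityMeasure Q]
    (h : IsPoissonSource μ Q T X) (hr : Measurable r) (hr1 : ∫⁻ u, r u ∂Q = 1) {K : Ω → ℕ}
    (hK : ∀ᵐ ω ∂μ, (∀ i, scoreSeq r (fun i => T i ω, fun i => X i ω) (K ω) ≤
      scoreSeq r (fun i => T i ω, fun i => X i ω) i) ∧
      scoreSeq r (fun i => T i ω, fun i => X i ω) (K ω) ≠ ∞)
    {g₁ g₂ : U → ℝ≥0∞} (hg₁ : Measurable g₁) (hg₂ : Measurable g₂) :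
    ∫⁻ ω, ((K ω + 1 : ℝ≥0∞) * g₁ (X (K ω) ω) + g₂ (X (K ω) ω)) ∂μ ≤
      ∫⁻ u, r u * ((1 + r u) * g₁ u + g₂ u) ∂Q := by
  classical
  have hΦ : ∀ {g : U → ℝ≥0∞}, Measurable g →
      Measurable fun p : ℝ≥0∞ × U => if p.1 = ∞ then 0 else g p.2 := fun hg =>
    Measurable.ite (measurable_fst (measurableSet_singleton ∞)) measurable_const
      (hg.comp measurable_snd)
  have hm1 := fun k : ℕ => h.measurable_scoreTerm hr measurableSet_le' k (hΦ hg₁) k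
  have hm2 := fun k : ℕ => h.measurable_scoreTerm hr measurableSet_le' 1 (hΦ (hg₁.add hg₂)) k
  simp only [one_mul] at hm2
  calc _ ≤ ∫⁻ ω, (∑' k : ℕ, (if ∀ j, scoreSeq r (fun i => T i ω, fun i => X i ω) k ≤
        scoreSeq r (fun i => T i ω, fun i => X i ω) (skipIndex k j) then
        k * (if scoreSeq r (fun i => T i ω, fun i => X i ω) k = ∞ then 0 else g₁ (X k ω)) else 0) +
        ∑' k : ℕ, (if ∀ j, scoreSeq r (fun i => T i ω, fun i => X i ω) k ≤
        scoreSeq r (fun i => T i ω, fun i => X i ω) (skipIndex k j) then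
        (if scoreSeq r (fun i => T i ω, fun i => X i ω) k = ∞ then 0 else
          (g₁ + g₂) (X k ω)) else 0)) ∂μ := by
        refine lintegral_mono_ae ?_
        filter_upwards [hK] with ω ⟨hω, hω'⟩
        refine le_trans (le_of_eq ?_) (add_le_add (ENNReal.le_tsum (K ω)) (ENNReal.le_tsum (K ω)))
        rw [if_pos fun j => hω _, if_pos fun j => hω _, if_neg hω', if_neg hω', Pi.add_apply]
        ring
    _ = ∑' k : ℕ, (∫⁻ ω, (if ∀ j, scoreSeq r (fun i => T i ω, fun i => X i ω) k ≤
        scoreSeq r (fun i => T i ω, fun i => X i ω) (skipIndex k j) then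
        k * (if scoreSeq r (fun i => T i ω, fun i => X i ω) k = ∞ then 0 else g₁ (X k ω)) else 0) ∂μ)
        + ∑' k : ℕ, (∫⁻ ω, (if ∀ j, scoreSeq r (fun i => T i ω, fun i => X i ω) k ≤
        scoreSeq r (fun i => T i ω, fun i => X i ω) (skipIndex k j) then
        (if scoreSeq r (fun i => T i ω, fun i => X i ω) k = ∞ then 0 else
          (g₁ + g₂) (X k ω)) else 0) ∂μ) := by
        rw [lintegral_add_left (Measurable.tsum hm1),
          lintegral_tsum fun k => (hm1 k).aemeasurable,
          lintegral_tsum fun k => (hm2 k).aemeasurable]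
    _ ≤ ∫⁻ u, r u * (r u * g₁ u) ∂Q + ∫⁻ u, r u * (g₁ + g₂) u ∂Q :=
        add_le_add (h.tsum_index_mul_minimizer_le hr hr1 hg₁)
          (h.tsum_minimizer_le hr hr1 (hg₁.add hg₂))
    _ = _ := by
        rw [← lintegral_add_left (by fun_prop)]
        refine lintegral_congr fun u => ?_
        rw [Pi.add_apply]
        ring

end Minimizer

/-! ### Tangent inequalities for powers and logarithms. -/

section RealInequalities

lemma rpow_le_tangent {x m σ : ℝ} (hx : 0 ≤ x) (hm : 0 < m) (h0 : 0 ≤ σ) (h1 : σ ≤ 1) :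
    x ^ σ ≤ σ * m ^ (σ - 1) * x + (1 - σ) * m ^ σ := by
  have h := Real.geom_mean_le_arith_mean2_weighted h0 (sub_nonneg.mpr h1)
    (div_nonneg hx hm.le) zero_le_one (by ring)
  rw [Real.one_rpow, mul_one, mul_one, Real.div_rpow hx hm.le,
    div_le_iff₀ (Real.rpow_pos_of_pos hm σ)] at h
  refine h.trans (le_of_eq ?_)
  rw [Real.rpow_sub hm, Real.rpow_one]
  field_simp

lemma log_add_one_le_tangent {x m : ℝ} (hx : 0 < x) (hm : 0 < m) :
    Real.log x + 1 ≤ Real.log m + m⁻¹ * x := by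
  have h := Real.log_le_sub_one_of_pos (div_pos hx hm)
  rw [Real.log_div hx.ne' hm.ne', div_eq_inv_mul] at h
  linarith

/-- The tangent of log at 2x. The terms 1/2 and x/2 cancel after integration against Q, as E_Q r =
1, leaving E_P log(1 + r) ≤ KL + ln 2. -/
lemma mul_log_one_add_le_klFun {x : ℝ} (hx : 0 ≤ x) :
    x * Real.log (1 + x) + 1 / 2 ≤ InformationTheory.klFun x + (1 / 2 + Real.log 2) * x := by
  unfold InformationTheory.klFun
  rcases hx.eq_or_lt with rfl | hx
  · simp; norm_num
  · have h := log_add_one_le_tangent (x := 1 + x) (m := 2 * x) (by positivity) (by positivity)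
    rw [Real.log_mul two_ne_zero hx.ne'] at h
    have h2 := mul_le_mul_of_nonneg_left h hx.le
    have h3 : x * ((2 * x)⁻¹ * (1 + x)) = (1 + x) / 2 := by field_simp
    rw [mul_add, mul_add, h3] at h2
    linarith

/-- The tangent of y^γ at x reduces this to x^γ + x ≤ x^(1+γ) + 1, a sum of two Bernoulli
inequalities. The terms in γ/2 cancel under E_Q when E_Q r = 1. -/
lemma mul_one_add_rpow_le {x γ : ℝ} (hx : 0 ≤ x) (h0 : 0 ≤ γ) (h1 : γ ≤ 1) :
    x * ((1 + x) / 2) ^ γ + γ / 2 * x ≤ x ^ (1 + γ) + γ / 2 := by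
  rcases hx.eq_or_lt with rfl | hx
  · rw [Real.zero_rpow (by linarith)]; simp; linarith
  have ha : ((1 + x) / 2) ^ γ ≤ γ * x ^ (γ - 1) * ((1 + x) / 2) + (1 - γ) * x ^ γ :=
    rpow_le_tangent (by positivity) hx h0 h1
  have e1 : x ^ γ = x ^ (γ - 1) * x := by
    rw [← Real.rpow_add_one hx.ne']; ring_nf
  have e2 : x ^ (1 + γ) = x ^ (γ - 1) * x * x := by
    rw [add_comm, Real.rpow_add_one hx.ne', e1]
  have hb : x ^ γ ≤ 1 + γ * (x - 1) := by
    have := rpow_one_add_le_one_add_mul_self (s := x - 1) (by linarith) h0 h1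
    simpa using this
  have hc : 1 + (1 + γ) * (x - 1) ≤ x ^ (1 + γ) := by
    have := one_add_mul_self_le_rpow_one_add (s := x - 1) (by linarith) (p := 1 + γ) (by linarith)
    simpa using this
  have ha' := mul_le_mul_of_nonneg_left ha hx.le
  rw [e2] at hc ⊢
  rw [e1] at hb ha'
  nlinarith [mul_le_mul_of_nonneg_left hb h0, mul_le_mul_of_nonneg_left hc h0]

end RealInequalities

/-! ### Jensen's inequality without integrability assumptions. -/

section Jensen

variable {Ω : Type*} [MeasurableSpace Ω] {μ : Measure Ω} [IsProbabilityMeasure μ]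

/-- The tangent at `m` is integrated. The added 1 avoids the possibly negative intercept log m - 1,
so that all terms live in [0, ∞]. -/
lemma lintegral_ofReal_log_le {Y : Ω → ℝ} {m : ℝ} (hY : ∀ ω, 1 ≤ Y ω) (hm : 1 ≤ m)
    (h : ∫⁻ ω, ENNReal.ofReal (Y ω) ∂μ ≤ ENNReal.ofReal m) :
    ∫⁻ ω, ENNReal.ofReal (Real.log (Y ω)) ∂μ ≤ ENNReal.ofReal (Real.log m) := by
  have hm0 : 0 < m := by linarith
  have key : ∫⁻ ω, ENNReal.ofReal (Real.log (Y ω)) ∂μ + 1 ≤ ENNReal.ofReal (Real.log m) + 1 := by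
    calc _ = ∫⁻ ω, (ENNReal.ofReal (Real.log (Y ω)) + 1) ∂μ := by
          rw [lintegral_add_right _ measurable_const]; simp
      _ ≤ ∫⁻ ω, (ENNReal.ofReal (Real.log m) + ENNReal.ofReal m⁻¹ * ENNReal.ofReal (Y ω)) ∂μ := by
          refine lintegral_mono fun ω => ?_
          rw [← ENNReal.ofReal_one, ← ENNReal.ofReal_mul (by positivity),
            ← ENNReal.ofReal_add (Real.log_nonneg (hY ω)) zero_le_one,
            ← ENNReal.ofReal_add (Real.log_nonneg hm)
              (mul_nonneg (by positivity) (by linarith [hY ω]))]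
          exact ENNReal.ofReal_le_ofReal (log_add_one_le_tangent (by linarith [hY ω]) hm0)
      _ = ENNReal.ofReal (Real.log m) + ENNReal.ofReal m⁻¹ * ∫⁻ ω, ENNReal.ofReal (Y ω) ∂μ := by
          rw [lintegral_add_left measurable_const, lintegral_const_mul' _ _ ENNReal.ofReal_ne_top]
          simp
      _ ≤ ENNReal.ofReal (Real.log m) + ENNReal.ofReal m⁻¹ * ENNReal.ofReal m := by gcongr
      _ = _ := by
          rw [← ENNReal.ofReal_mul (by positivity), inv_mul_cancel₀ hm0.ne', ENNReal.ofReal_one]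
  exact ENNReal.le_of_add_le_add_right ENNReal.one_ne_top key

lemma lintegral_ofReal_rpow_le {Y : Ω → ℝ} {m σ : ℝ} (hY : ∀ ω, 0 ≤ Y ω) (hm : 0 < m)
    (h0 : 0 ≤ σ) (h1 : σ ≤ 1) (h : ∫⁻ ω, ENNReal.ofReal (Y ω) ∂μ ≤ ENNReal.ofReal m) :
    ∫⁻ ω, ENNReal.ofReal (Y ω ^ σ) ∂μ ≤ ENNReal.ofReal (m ^ σ) := by
  have hp : 0 ≤ σ * m ^ (σ - 1) := by positivity
  have hq : 0 ≤ (1 - σ) * m ^ σ := mul_nonneg (by linarith) (by positivity)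
  calc _ ≤ ∫⁻ ω, (ENNReal.ofReal (σ * m ^ (σ - 1)) * ENNReal.ofReal (Y ω) +
          ENNReal.ofReal ((1 - σ) * m ^ σ)) ∂μ := by
        refine lintegral_mono fun ω => ?_
        rw [← ENNReal.ofReal_mul hp, ← ENNReal.ofReal_add (mul_nonneg hp (hY ω)) hq]
        exact ENNReal.ofReal_le_ofReal (rpow_le_tangent (hY ω) hm h0 h1)
    _ = ENNReal.ofReal (σ * m ^ (σ - 1)) * ∫⁻ ω, ENNReal.ofReal (Y ω) ∂μ +
          ENNReal.ofReal ((1 - σ) * m ^ σ) := by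
        rw [lintegral_add_right _ measurable_const, lintegral_const_mul' _ _ ENNReal.ofReal_ne_top]
        simp
    _ ≤ ENNReal.ofReal (σ * m ^ (σ - 1)) * ENNReal.ofReal m +
          ENNReal.ofReal ((1 - σ) * m ^ σ) := by gcongr
    _ = _ := by
        rw [← ENNReal.ofReal_mul hp, ← ENNReal.ofReal_add (mul_nonneg hp hm.le) hq]
        congr 1
        rw [Real.rpow_sub hm, Real.rpow_one]
        field_simp
        ring

end Jensen

/-! ### Moments of the index of the Poisson functional representation. -/

section Index

variable {Ω U : Type*} [MeasurableSpace Ω] [MeasurableSpace U] {μ : Measure Ω}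
  {P Q : Measure U} {T : ℕ → Ω → ℝ} {X : ℕ → Ω → U}

lemma lintegral_rnDeriv_eq_one [IsProbabilityMeasure P] [IsProbabilityMeasure Q] (hPQ : P ≪ Q) :
    ∫⁻ u, P.rnDeriv Q u ∂Q = 1 := by
  rw [Measure.lintegral_rnDeriv hPQ, measure_univ]

lemma IsPoissonSource.measurable_comp_pfrIndex (h : IsPoissonSource μ Q T X) {β : Type*}
    [MeasurableSpace β] (f : ℕ+ → β) : Measurable fun ω => f (pfrIndex P Q T X ω) := by
  have hs : ∀ i, Measurable fun ω => pfrScore P Q T X i ω := fun i =>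
    (h.arrivals.measurable i).ennreal_ofReal.div
      ((Measure.measurable_rnDeriv P Q).comp (h.measurable i))
  have hA : ∀ k, MeasurableSet {ω | ∀ i, pfrScore P Q T X k ω ≤ pfrScore P Q T X i ω} := fun k => by
    rw [Set.ofPred_forall]
    exact MeasurableSet.iInter fun i => measurableSet_le (hs k) (hs i)
  have hK : Measurable fun ω =>
      sInf {k : ℕ | ∀ i : ℕ, pfrScore P Q T X k ω ≤ pfrScore P Q T X i ω} := by
    refine measurable_of_Ici fun n => ?_
    have : (fun ω => sInf {k : ℕ | ∀ i : ℕ, pfrScore P Q T X k ω ≤ pfrScore P Q T X i ω}) ⁻¹'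
        -- The infimum of the empty set is 0, so for `n > 0` a minimizer must also be required to
        -- exist.
        (Set.Ici n) = {ω | n = 0} ∪
        ((⋃ k, {ω | ∀ i, pfrScore P Q T X k ω ≤ pfrScore P Q T X i ω}) ∩
        (⋂ k ∈ Finset.range n, {ω | ∀ i, pfrScore P Q T X k ω ≤ pfrScore P Q T X i ω}ᶜ)) := by
      ext ω
      simp only [Set.mem_preimage, Set.mem_Ici, Set.mem_union, Set.mem_inter_iff, Set.mem_iUnion,
        Set.mem_iInter, Finset.mem_range, Set.mem_compl_iff, Set.mem_ofPred_eq]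
      constructor
      · intro hn
        by_cases h0 : n = 0
        · exact Or.inl h0
        · refine Or.inr ⟨?_, fun k hk hk' => ?_⟩
          · have := Nat.nonempty_of_pos_sInf (lt_of_lt_of_le (Nat.pos_of_ne_zero h0) hn)
            exact this
          · exact absurd (hn.trans (Nat.sInf_le hk')) (by omega)
      · rintro (h0 | ⟨⟨k, hk⟩, h2⟩)
        · omega
        · by_contra! hlt
          exact h2 _ hlt (Nat.sInf_mem (s := {k : ℕ | ∀ i : ℕ,
            pfrScore P Q T X k ω ≤ pfrScore P Q T X i ω}) ⟨k, hk⟩)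
    rw [this]
    refine (MeasurableSet.const _).union ((MeasurableSet.iUnion hA).inter ?_)
    exact MeasurableSet.biInter (Finset.countable_toSet _) fun k _ => (hA k).compl
  exact (measurable_from_nat (f := fun n => f (Nat.succPNat n))).comp hK

/-- This stands in for conditional Jensen given the selected mark: `f` is majorized by affine
functions whose coefficients depend on the mark. Tangents at 1 + r(u) make the right side E_P f(1 +
r). -/
lemma IsPoissonSource.lintegral_pfrIndex_le [IsProbabilityMeasure μ] [IsProbabilityMeasure P]
    [IsProbabilityMeasure Q] (h : IsPoissonSource μ Q T X) (hPQ : P ≪ Q)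
    {g₁ g₂ : U → ℝ≥0∞} (hg₁ : Measurable g₁) (hg₂ : Measurable g₂) {f : ℕ+ → ℝ≥0∞}
    (hf : ∀ k u, f k ≤ ((k : ℕ) : ℝ≥0∞) * g₁ u + g₂ u) :
    ∫⁻ ω, f (pfrIndex P Q T X ω) ∂μ ≤
      ∫⁻ u, P.rnDeriv Q u * ((1 + P.rnDeriv Q u) * g₁ u + g₂ u) ∂Q := by
  have hr := Measure.measurable_rnDeriv P Q
  have hr1 := lintegral_rnDeriv_eq_one hPQ
  refine le_trans ?_ (h.lintegral_minimizer_le hr hr1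
    (K := fun ω => sInf {k : ℕ | ∀ i : ℕ, pfrScore P Q T X k ω ≤ pfrScore P Q T X i ω})
    ?_ hg₁ hg₂)
  · refine lintegral_mono fun ω => (hf _ (X (sInf {k : ℕ | ∀ i : ℕ,
      pfrScore P Q T X k ω ≤ pfrScore P Q T X i ω}) ω)).trans (le_of_eq ?_)
    simp [pfrIndex]
  · filter_upwards [h.ae_exists_minimizer hr hr1] with ω ⟨h1, k, hk⟩
    have hmem : ∀ i, pfrScore P Q T X (sInf {k : ℕ | ∀ i : ℕ, pfrScore P Q T X k ω ≤
      pfrScore P Q T X i ω}) ω ≤ pfrScore P Q T X i ω :=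
      Nat.sInf_mem (s := {k : ℕ | ∀ i : ℕ,
            pfrScore P Q T X k ω ≤ pfrScore P Q T X i ω}) h1
    exact ⟨hmem, ne_top_of_le_ne_top hk (hmem k)⟩

lemma IsPoissonSource.lintegral_rpow_pfrIndex_le [IsProbabilityMeasure μ]
    [IsProbabilityMeasure P] [IsProbabilityMeasure Q] (h : IsPoissonSource μ Q T X) (hPQ : P ≪ Q)
    {γ : ℝ} (h0 : 0 < γ) (h1 : γ < 1) :
    ∫⁻ ω, ENNReal.ofReal ((pfrIndex P Q T X ω : ℝ) ^ γ) ∂μ ≤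
      ENNReal.ofReal (2 ^ γ) * ∫⁻ u, P.rnDeriv Q u ^ (1 + γ) ∂Q := by
  have hr := Measure.measurable_rnDeriv P Q
  have hr1 := lintegral_rnDeriv_eq_one hPQ
  have hfin := Measure.rnDeriv_ne_top P Q
  have hfin' : ∀ᵐ u ∂Q, P.rnDeriv Q u ≠ ∞ := hfin
  set r := P.rnDeriv Q with hrdef
  set g₁ : U → ℝ≥0∞ := fun u => ENNReal.ofReal (γ * (1 + (r u).toReal) ^ (γ - 1))
  set g₂ : U → ℝ≥0∞ := fun u => ENNReal.ofReal ((1 - γ) * (1 + (r u).toReal) ^ γ)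
  have hg₁ : Measurable g₁ := by fun_prop
  have hg₂ : Measurable g₂ := by fun_prop
  have hA := h.lintegral_pfrIndex_le hPQ hg₁ hg₂ (f := fun k => ENNReal.ofReal ((k : ℝ) ^ γ)) ?_
  · refine hA.trans ?_
    -- The constant is added because the pointwise inequality holds only modulo a multiple of 1 - r,
    -- which integrates to zero.
    have key : ∫⁻ u, r u * ((1 + r u) * g₁ u + g₂ u) ∂Q + ENNReal.ofReal (2 ^ γ * (γ / 2)) ≤
        ENNReal.ofReal (2 ^ γ) * ∫⁻ u, r u ^ (1 + γ) ∂Q + ENNReal.ofReal (2 ^ γ * (γ / 2)) := by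
      calc _ = ∫⁻ u, (r u * ((1 + r u) * g₁ u + g₂ u) + ENNReal.ofReal (2 ^ γ * (γ / 2)) * r u) ∂Q := by
            rw [lintegral_add_right _ (by fun_prop), lintegral_const_mul _ hr, hr1, mul_one]
        _ ≤ ∫⁻ u, (ENNReal.ofReal (2 ^ γ) * r u ^ (1 + γ) + ENNReal.ofReal (2 ^ γ * (γ / 2))) ∂Q := by
            refine lintegral_mono_ae ?_
            filter_upwards [hfin'] with u hu
            have hx : 0 ≤ (r u).toReal := ENNReal.toReal_nonneg
            have hxe : r u = ENNReal.ofReal (r u).toReal := (ENNReal.ofReal_toReal hu).symm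
            simp only [g₁, g₂]
            rw [hxe]
            simp only [ENNReal.toReal_ofReal hx]
            generalize (r u).toReal = x at hx
            have e1 : (1 + x) ^ (γ - 1) * (1 + x) = (1 + x) ^ γ := by
              rw [← Real.rpow_add_one (by positivity)]; ring_nf
            have hq : 0 ≤ (1 - γ) * (1 + x) ^ γ := mul_nonneg (by linarith) (by positivity)
            rw [ENNReal.ofReal_rpow_of_nonneg hx (by linarith), ← ENNReal.ofReal_one,
              ← ENNReal.ofReal_add zero_le_one hx, ← ENNReal.ofReal_mul (by positivity),
              ← ENNReal.ofReal_add (by positivity) hq, ← ENNReal.ofReal_mul hx,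
              ← ENNReal.ofReal_mul (by positivity), ← ENNReal.ofReal_mul (by positivity),
              ← ENNReal.ofReal_add (mul_nonneg hx (add_nonneg (by positivity) hq)) (by positivity),
              ← ENNReal.ofReal_add (by positivity) (by positivity)]
            refine ENNReal.ofReal_le_ofReal ?_
            have hm := mul_le_mul_of_nonneg_left (mul_one_add_rpow_le hx h0.le h1.le)
              (show (0 : ℝ) ≤ 2 ^ γ by positivity)
            have h2 : (2 : ℝ) ^ γ * ((1 + x) / 2) ^ γ = (1 + x) ^ γ := by
              rw [← Real.mul_rpow (by positivity) (by positivity)]; congr 1; ring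
            have e3 : x * ((1 + x) * (γ * (1 + x) ^ (γ - 1)) + (1 - γ) * (1 + x) ^ γ) =
                x * (1 + x) ^ γ := by
              linear_combination x * γ * e1
            rw [e3, ← h2]
            linarith
        _ = _ := by
            rw [lintegral_add_right _ measurable_const, lintegral_const_mul _ (by fun_prop)]
            simp
    exact ENNReal.le_of_add_le_add_right ENNReal.ofReal_ne_top key
  · intro k u
    have hx : 0 ≤ (r u).toReal := ENNReal.toReal_nonneg
    have hk : ((k : ℕ) : ℝ≥0∞) = ENNReal.ofReal (k : ℝ) := by simp
    simp only [g₁, g₂, hk]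
    rw [← ENNReal.ofReal_mul (by positivity), ← ENNReal.ofReal_add (by positivity)
      (mul_nonneg (by linarith) (by positivity))]
    refine ENNReal.ofReal_le_ofReal ?_
    rw [mul_comm (k : ℝ)]
    exact rpow_le_tangent (by positivity) (by positivity) h0.le h1.le

lemma IsPoissonSource.lintegral_log_pfrIndex_le [IsProbabilityMeasure μ]
    [IsProbabilityMeasure P] [IsProbabilityMeasure Q] (h : IsPoissonSource μ Q T X) (hPQ : P ≪ Q) :
    ∫⁻ ω, ENNReal.ofReal (Real.log (pfrIndex P Q T X ω : ℝ)) ∂μ ≤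
      InformationTheory.klDiv P Q + ENNReal.ofReal (Real.log 2) := by
  have hr := Measure.measurable_rnDeriv P Q
  have hr1 := lintegral_rnDeriv_eq_one hPQ
  have hfin : ∀ᵐ u ∂Q, P.rnDeriv Q u ≠ ∞ := Measure.rnDeriv_ne_top P Q
  rw [InformationTheory.klDiv_eq_lintegral_klFun_of_ac hPQ]
  set r := P.rnDeriv Q with hrdef
  set g₁ : U → ℝ≥0∞ := fun u => ENNReal.ofReal (1 + (r u).toReal)⁻¹
  set g₂ : U → ℝ≥0∞ := fun u => ENNReal.ofReal (Real.log (1 + (r u).toReal))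
  have hg₁ : Measurable g₁ := by fun_prop
  have hg₂ : Measurable g₂ := by fun_prop
  -- The tangent at 1 + r has intercept log(1 + r) - 1; its -1 is moved to `f`, so that `g₂` is
  -- nonnegative.
  have hA := h.lintegral_pfrIndex_le hPQ hg₁ hg₂
    (f := fun k => ENNReal.ofReal (Real.log (k : ℝ)) + 1) ?_
  · rw [lintegral_add_right _ measurable_const, lintegral_const, measure_univ, mul_one] at hA
    have key : ∫⁻ ω, ENNReal.ofReal (Real.log (pfrIndex P Q T X ω : ℝ)) ∂μ +
        (1 + ENNReal.ofReal (1 / 2)) ≤ ∫⁻ u, ENNReal.ofReal (InformationTheory.klFun (r u).toReal) ∂Q +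
          ENNReal.ofReal (Real.log 2) + (1 + ENNReal.ofReal (1 / 2)) := by
      rw [← add_assoc]
      refine (add_le_add_left hA _).trans ?_
      calc _ = ∫⁻ u, (r u * ((1 + r u) * g₁ u + g₂ u) + ENNReal.ofReal (1 / 2)) ∂Q := by
            rw [lintegral_add_right _ measurable_const, lintegral_const, measure_univ, mul_one]
        _ ≤ ∫⁻ u, (ENNReal.ofReal (InformationTheory.klFun (r u).toReal) +
              ENNReal.ofReal (3 / 2 + Real.log 2) * r u) ∂Q := by
            refine lintegral_mono_ae ?_
            filter_upwards [hfin] with u hu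
            have hx : 0 ≤ (r u).toReal := ENNReal.toReal_nonneg
            have hxe : r u = ENNReal.ofReal (r u).toReal := (ENNReal.ofReal_toReal hu).symm
            simp only [g₁, g₂]
            rw [hxe]
            simp only [ENNReal.toReal_ofReal hx]
            generalize (r u).toReal = x at hx
            have hl : 0 ≤ Real.log (1 + x) := Real.log_nonneg (by linarith)
            have hl2 : 0 ≤ Real.log 2 := Real.log_nonneg (by norm_num)
            rw [← ENNReal.ofReal_one, ← ENNReal.ofReal_add zero_le_one hx,
              ← ENNReal.ofReal_mul (by positivity), ← ENNReal.ofReal_add (by positivity) hl,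
              ← ENNReal.ofReal_mul hx, ← ENNReal.ofReal_add (by positivity) (by positivity),
              ← ENNReal.ofReal_mul (by positivity),
              ← ENNReal.ofReal_add (InformationTheory.klFun_nonneg hx) (by positivity)]
            refine ENNReal.ofReal_le_ofReal ?_
            rw [mul_inv_cancel₀ (by positivity)]
            linarith [mul_log_one_add_le_klFun hx]
        _ = _ := by
            have hl2 : 0 ≤ Real.log 2 := Real.log_nonneg (by norm_num)
            rw [lintegral_add_right _ (by fun_prop), lintegral_const_mul _ hr, hr1, mul_one,
              ← ENNReal.ofReal_one, ← ENNReal.ofReal_add zero_le_one (by norm_num), add_assoc,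
              ← ENNReal.ofReal_add hl2 (by norm_num)]
            ring_nf
    exact ENNReal.le_of_add_le_add_right (by simp) key
  · intro k u
    have hx : 0 ≤ (r u).toReal := ENNReal.toReal_nonneg
    have hk : ((k : ℕ) : ℝ≥0∞) = ENNReal.ofReal (k : ℝ) := by simp
    have hk1 : (1 : ℝ) ≤ (k : ℝ) := by exact_mod_cast one_le
    simp only [g₁, g₂, hk]
    rw [← ENNReal.ofReal_mul (by positivity), ← ENNReal.ofReal_one,
      ← ENNReal.ofReal_add (Real.log_nonneg hk1) zero_le_one,
      ← ENNReal.ofReal_add (by positivity) (Real.log_nonneg (by linarith))]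
    refine ENNReal.ofReal_le_ofReal ?_
    have := log_add_one_le_tangent (x := (k : ℝ)) (m := 1 + (r u).toReal) (by positivity)
      (by positivity)
    linarith

end Index

/-! ### Extended logarithms, constants and Rényi divergence. -/

lemma log2E_ofReal {x : ℝ} (hx : 0 < x) :
    log2E (ENNReal.ofReal x) = ((Real.logb 2 x : ℝ) : EReal) := by
  rw [log2E, ENNReal.log_ofReal_of_pos hx, ← EReal.coe_div, Real.logb]

lemma log2E_mono : Monotone log2E := fun _ _ hab =>
  EReal.div_le_div_right_of_nonneg (by exact_mod_cast Real.log_nonneg (by norm_num))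
    (ENNReal.log_monotone hab)

lemma log2E_top : log2E ∞ = ⊤ := by
  rw [log2E, ENNReal.log_top]
  exact EReal.top_div_of_pos_ne_top (by exact_mod_cast Real.log_pos (by norm_num))
    (EReal.coe_ne_top _)

lemma log2E_klBits_add_one {U : Type*} [MeasurableSpace U] {P Q : Measure U}
    (h : klBits P Q ≠ ∞) :
    log2E (klBits P Q + 1) = ((Real.logb 2 ((klBits P Q).toReal + 1) : ℝ) : EReal) := by
  rw [← log2E_ofReal (by positivity), ENNReal.ofReal_add (by positivity) zero_le_one,
    ENNReal.ofReal_toReal h, ENNReal.ofReal_one]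

lemma lengthConst_nonneg {ε : ℝ} (hε : 0 < ε) : 0 ≤ lengthConst ε := by
  have h2 : 0 < Real.log 2 := Real.log_pos (by norm_num)
  have : 0 ≤ Real.logb 2 (Real.log 2 / ε + 3 / 2) :=
    Real.logb_nonneg (by norm_num) (by have : 0 ≤ Real.log 2 / ε := by positivity
                                       linarith)
  unfold lengthConst
  linarith

lemma c2_eq (ε : ℝ) : c2 ε = lengthConst ε + 2 + ε := by
  unfold c2 lengthConst
  ring

lemma logb_add_two_le {d : ℝ} (hd : 0 ≤ d) : Real.logb 2 (d + 2) ≤ Real.logb 2 (d + 1) + 1 := by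
  have : Real.logb 2 (d + 1) + 1 = Real.logb 2 ((d + 1) * 2) := by
    rw [Real.logb_mul (by positivity) (by norm_num), Real.logb_self_eq_one (by norm_num)]
  rw [this]
  exact Real.logb_le_logb_of_le (by norm_num) (by positivity) (by linarith)

lemma one_le_pnat_cast (k : ℕ+) : (1 : ℝ) ≤ (k : ℝ) := by exact_mod_cast one_le

lemma one_le_logb_add_one (k : ℕ+) : 1 ≤ Real.logb 2 ((k : ℝ) + 1) := by
  rw [Real.le_logb_iff_rpow_le (by norm_num) (by positivity), Real.rpow_one]
  linarith [one_le_pnat_cast k]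

lemma logb_add_one_le (k : ℕ+) : Real.logb 2 ((k : ℝ) + 1) ≤ Real.logb 2 (k : ℝ) + 1 := by
  have : Real.logb 2 (k : ℝ) + 1 = Real.logb 2 ((k : ℝ) * 2) := by
    rw [Real.logb_mul (by positivity) (by norm_num), Real.logb_self_eq_one (by norm_num)]
  rw [this]
  exact Real.logb_le_logb_of_le (by norm_num) (by positivity) (by linarith [one_le_pnat_cast k])

section Renyi

variable {U : Type*} [MeasurableSpace U] {P Q : Measure U}

lemma lintegral_rnDeriv_rpow_ne_zero [IsProbabilityMeasure P] [IsProbabilityMeasure Q] (hPQ : P ≪ Q) {β : ℝ} (hβ : 0 < β) :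
    ∫⁻ u, P.rnDeriv Q u ^ β ∂Q ≠ 0 := by
  intro h0
  rw [lintegral_eq_zero_iff (by fun_prop)] at h0
  have h1 := lintegral_rnDeriv_eq_one hPQ
  rw [lintegral_congr_ae (g := fun _ => 0)] at h1
  · simp at h1
  · filter_upwards [h0] with u hu
    simpa [hβ.not_gt, hβ.le, hβ] using hu

lemma renyiDiv_eq_top {β : ℝ} (hβ : 1 < β) (h : ∫⁻ u, P.rnDeriv Q u ^ β ∂Q = ∞) :
    renyiDiv β P Q = ⊤ := by
  rw [renyiDiv, h, log2E_top]
  exact EReal.coe_mul_top_of_pos (inv_pos.mpr (by linarith))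

lemma renyiDiv_eq_coe [IsProbabilityMeasure P] [IsProbabilityMeasure Q] (hPQ : P ≪ Q) {β : ℝ} (hβ : 1 < β) (h : ∫⁻ u, P.rnDeriv Q u ^ β ∂Q ≠ ∞) :
    renyiDiv β P Q =
      (((β - 1)⁻¹ * Real.logb 2 (∫⁻ u, P.rnDeriv Q u ^ β ∂Q).toReal : ℝ) : EReal) := by
  have h0 := lintegral_rnDeriv_rpow_ne_zero hPQ (show 0 < β by linarith)
  rw [renyiDiv, EReal.coe_mul, ← log2E_ofReal (ENNReal.toReal_pos h0 h), ENNReal.ofReal_toReal h]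

/-- Excludes ⊥ + ⊤ = ⊥ on the right of the Campbell bound when the divergence is infinite. -/
lemma renyiDiv_ne_bot [IsProbabilityMeasure P] [IsProbabilityMeasure Q] (hPQ : P ≪ Q) {β : ℝ} (hβ : 1 < β) : renyiDiv β P Q ≠ ⊥ := by
  by_cases h : ∫⁻ u, P.rnDeriv Q u ^ β ∂Q = ∞
  · rw [renyiDiv_eq_top hβ h]; exact top_ne_bot
  · rw [renyiDiv_eq_coe hPQ hβ h]; exact EReal.coe_ne_bot _

end Renyi

lemma coe_mul_log2E_top_add {ε c : ℝ} (hε : 0 < ε) {x : EReal} (hx : x ≠ ⊥) :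
    x + ((1 + ε : ℝ) : EReal) * log2E (∞ + 1) + (c : EReal) = ⊤ := by
  rw [top_add, log2E_top, EReal.coe_mul_top_of_pos (by linarith), EReal.add_top_of_ne_bot hx,
    EReal.top_add_coe]

/-! ### The bounds on the expected length and on the Campbell cost. -/

section Bounds

variable {Ω U : Type*} [MeasurableSpace Ω] [MeasurableSpace U] {μ : Measure Ω}
  {P Q : Measure U} {T : ℕ → Ω → ℝ} {X : ℕ → Ω → U} [IsProbabilityMeasure μ]
  [IsProbabilityMeasure P] [IsProbabilityMeasure Q]

lemma IsPoissonSource.lintegral_logb_pfrIndex_le (h : IsPoissonSource μ Q T X) (hPQ : P ≪ Q) :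
    ∫⁻ ω, ENNReal.ofReal (Real.logb 2 (pfrIndex P Q T X ω : ℝ)) ∂μ ≤ klBits P Q + 1 := by
  have hl : 0 < Real.log 2 := Real.log_pos (by norm_num)
  have hl' : ENNReal.ofReal (Real.log 2) ≠ 0 := by simpa using hl
  simp only [Real.logb, ENNReal.ofReal_div_of_pos hl]
  simp only [div_eq_mul_inv]
  rw [lintegral_mul_const' _ _ (by simpa using hl), klBits, ← div_eq_mul_inv]
  refine (ENNReal.div_le_div_right (h.lintegral_log_pfrIndex_le hPQ) _).trans (le_of_eq ?_)
  rw [ENNReal.add_div, ENNReal.div_self hl' ENNReal.ofReal_ne_top]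

lemma IsPoissonSource.lintegral_logb_add_one_le (h : IsPoissonSource μ Q T X) (hPQ : P ≪ Q)
    (hD : klBits P Q ≠ ∞) :
    ∫⁻ ω, ENNReal.ofReal (Real.logb 2 ((pfrIndex P Q T X ω : ℝ) + 1)) ∂μ ≤
      ENNReal.ofReal ((klBits P Q).toReal + 2) := by
  calc _ ≤ ∫⁻ ω, (ENNReal.ofReal (Real.logb 2 (pfrIndex P Q T X ω : ℝ)) + 1) ∂μ := by
        refine lintegral_mono fun ω => ?_
        rw [← ENNReal.ofReal_one, ← ENNReal.ofReal_add
          (Real.logb_nonneg (by norm_num) (one_le_pnat_cast _)) zero_le_one]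
        exact ENNReal.ofReal_le_ofReal (logb_add_one_le _)
    _ = ∫⁻ ω, ENNReal.ofReal (Real.logb 2 (pfrIndex P Q T X ω : ℝ)) ∂μ + 1 := by
        rw [lintegral_add_right _ measurable_const, lintegral_const, measure_univ, mul_one]
    _ ≤ klBits P Q + 1 + 1 := by gcongr; exact h.lintegral_logb_pfrIndex_le hPQ
    _ = _ := by
        rw [ENNReal.ofReal_add (by positivity) zero_le_two, ENNReal.ofReal_toReal hD, add_assoc,
          one_add_one_eq_two, ENNReal.ofReal_ofNat]

lemma IsPoissonSource.lintegral_logb_logb_le (h : IsPoissonSource μ Q T X) (hPQ : P ≪ Q)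
    (hD : klBits P Q ≠ ∞) :
    ∫⁻ ω, ENNReal.ofReal (Real.logb 2 (Real.logb 2 ((pfrIndex P Q T X ω : ℝ) + 1))) ∂μ ≤
      ENNReal.ofReal (Real.logb 2 ((klBits P Q).toReal + 2)) := by
  have hl : 0 < Real.log 2 := Real.log_pos (by norm_num)
  have hd : (0 : ℝ) ≤ (klBits P Q).toReal := ENNReal.toReal_nonneg
  have := lintegral_ofReal_log_le (fun ω => one_le_logb_add_one (pfrIndex P Q T X ω))
    (by linarith) (h.lintegral_logb_add_one_le hPQ hD)
  have e : ∀ x : ℝ, ENNReal.ofReal (Real.logb 2 x) =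
      ENNReal.ofReal (Real.log x) * (ENNReal.ofReal (Real.log 2))⁻¹ := fun x => by
    rw [Real.logb, ENNReal.ofReal_div_of_pos hl, div_eq_mul_inv]
  rw [e, lintegral_congr fun ω => e _, lintegral_mul_const' _ _ (by simpa using hl)]
  gcongr

variable {ε : ℝ} {C : ℕ+ → List Bool}

lemma IsPoissonSource.lintegral_length_le (h : IsPoissonSource μ Q T X) (hPQ : P ≪ Q)
    (hε : 0 < ε) (hC : ∀ k : ℕ+, ((C k).length : ℝ) ≤ lengthProfile ε k + lengthConst ε)
    (hD : klBits P Q ≠ ∞) :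
    expectedLength μ (pfrIndex P Q T X) C ≤ ENNReal.ofReal ((klBits P Q).toReal +
      (1 + ε) * Real.logb 2 ((klBits P Q).toReal + 1) + c2 ε) := by
  have hc := lengthConst_nonneg hε
  have hd : (0 : ℝ) ≤ (klBits P Q).toReal := ENNReal.toReal_nonneg
  have hε1 : 0 ≤ 1 + ε := by linarith
  have hll : ∀ k : ℕ+, 0 ≤ Real.logb 2 (Real.logb 2 ((k : ℝ) + 1)) := fun k =>
    Real.logb_nonneg (by norm_num) (one_le_logb_add_one k)
  have hl : ∀ k : ℕ+, 0 ≤ Real.logb 2 (k : ℝ) := fun k =>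
    Real.logb_nonneg (by norm_num) (one_le_pnat_cast k)
  have hd2 : 0 ≤ Real.logb 2 ((klBits P Q).toReal + 2) :=
    Real.logb_nonneg (by norm_num) (by linarith)
  calc _ ≤ ∫⁻ ω, (ENNReal.ofReal (Real.logb 2 (pfrIndex P Q T X ω : ℝ)) +
          ENNReal.ofReal (1 + ε) *
            ENNReal.ofReal (Real.logb 2 (Real.logb 2 ((pfrIndex P Q T X ω : ℝ) + 1))) +
          ENNReal.ofReal (lengthConst ε)) ∂μ := by
        refine lintegral_mono fun ω => ?_
        rw [← ENNReal.ofReal_mul hε1, ← ENNReal.ofReal_add (hl _) (mul_nonneg hε1 (hll _)),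
          ← ENNReal.ofReal_add (add_nonneg (hl _) (mul_nonneg hε1 (hll _))) hc,
          ← ENNReal.ofReal_natCast]
        exact ENNReal.ofReal_le_ofReal (hC _)
    _ = ∫⁻ ω, ENNReal.ofReal (Real.logb 2 (pfrIndex P Q T X ω : ℝ)) ∂μ +
          ENNReal.ofReal (1 + ε) *
            ∫⁻ ω, ENNReal.ofReal (Real.logb 2 (Real.logb 2 ((pfrIndex P Q T X ω : ℝ) + 1))) ∂μ +
          ENNReal.ofReal (lengthConst ε) := by
        rw [lintegral_add_right _ measurable_const, lintegral_add_left
          (h.measurable_comp_pfrIndex fun k => ENNReal.ofReal (Real.logb 2 (k : ℝ))),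
          lintegral_const_mul' _ _ ENNReal.ofReal_ne_top, lintegral_const, measure_univ, mul_one]
    _ ≤ ENNReal.ofReal ((klBits P Q).toReal + 1) +
          ENNReal.ofReal (1 + ε) * ENNReal.ofReal (Real.logb 2 ((klBits P Q).toReal + 2)) +
          ENNReal.ofReal (lengthConst ε) := by
        gcongr
        · rw [ENNReal.ofReal_add hd zero_le_one, ENNReal.ofReal_toReal hD, ENNReal.ofReal_one]
          exact h.lintegral_logb_pfrIndex_le hPQ
        · exact h.lintegral_logb_logb_le hPQ hD
    _ ≤ _ := by
        rw [← ENNReal.ofReal_mul hε1, ← ENNReal.ofReal_add (by positivity) (mul_nonneg hε1 hd2),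
          ← ENNReal.ofReal_add (add_nonneg (by positivity) (mul_nonneg hε1 hd2)) hc]
        refine ENNReal.ofReal_le_ofReal ?_
        rw [c2_eq]
        linarith [mul_le_mul_of_nonneg_left (logb_add_two_le hd) hε1]

/-- Cauchy–Schwarz separates K^t from log(K+1)^(t(1+ε)). The squares have exponents 2t < 1 and
2t(1+ε) ≤ 1, so the moment bound applies to the first and Jensen to the second. -/
lemma IsPoissonSource.lintegral_two_rpow_length_le (h : IsPoissonSource μ Q T X) (hPQ : P ≪ Q)
    (hε : 0 < ε) (hC : ∀ k : ℕ+, ((C k).length : ℝ) ≤ lengthProfile ε k + lengthConst ε)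
    (hD : klBits P Q ≠ ∞) {t : ℝ} (ht : 0 < t) (ht2 : 2 * t < 1) (htε : 2 * (t * (1 + ε)) ≤ 1) :
    ∫⁻ ω, (2 : ℝ≥0∞) ^ (t * ((C (pfrIndex P Q T X ω)).length : ℝ)) ∂μ ≤
      ENNReal.ofReal (2 ^ (t * (lengthConst ε + 1)) *
        ((klBits P Q).toReal + 2) ^ (t * (1 + ε))) *
        (∫⁻ u, P.rnDeriv Q u ^ (1 + 2 * t) ∂Q) ^ (1 / 2 : ℝ) := by
  have hd : (0 : ℝ) ≤ (klBits P Q).toReal := ENNReal.toReal_nonneg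
  have hε1 : 0 ≤ 1 + ε := by linarith
  have hs : 0 ≤ t * (1 + ε) := by positivity
  have hY : ∀ k : ℕ+, 0 < Real.logb 2 ((k : ℝ) + 1) := fun k =>
    lt_of_lt_of_le one_pos (one_le_logb_add_one k)
  set f : ℕ+ → ℝ≥0∞ := fun k => ENNReal.ofReal ((k : ℝ) ^ t)
  set g : ℕ+ → ℝ≥0∞ := fun k => ENNReal.ofReal (Real.logb 2 ((k : ℝ) + 1) ^ (t * (1 + ε)))
  have hf : ∀ k, f k ^ (2 : ℝ) = ENNReal.ofReal ((k : ℝ) ^ (2 * t)) := fun k => by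
    rw [ENNReal.ofReal_rpow_of_nonneg (by positivity) zero_le_two, ← Real.rpow_mul (by positivity),
      mul_comm]
  have hg : ∀ k, g k ^ (2 : ℝ) =
      ENNReal.ofReal (Real.logb 2 ((k : ℝ) + 1) ^ (2 * (t * (1 + ε)))) := fun k => by
    rw [ENNReal.ofReal_rpow_of_nonneg (Real.rpow_nonneg (hY k).le _) zero_le_two,
      ← Real.rpow_mul (hY k).le, mul_comm 2 (t * (1 + ε))]
  have hpt : ∀ k : ℕ+, (2 : ℝ≥0∞) ^ (t * ((C k).length : ℝ)) ≤
      ENNReal.ofReal (2 ^ (t * lengthConst ε)) * (f k * g k) := fun k => by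
    rw [← ENNReal.ofReal_mul (by positivity), ← ENNReal.ofReal_mul (by positivity),
      ← ENNReal.ofReal_ofNat 2, ENNReal.ofReal_rpow_of_pos zero_lt_two]
    refine ENNReal.ofReal_le_ofReal ?_
    have e1 : (k : ℝ) ^ t = 2 ^ (t * Real.logb 2 (k : ℝ)) := by
      rw [mul_comm, Real.rpow_mul zero_le_two, Real.rpow_logb two_pos (by norm_num) (by positivity)]
    have e2 : Real.logb 2 ((k : ℝ) + 1) ^ (t * (1 + ε)) =
        2 ^ (t * (1 + ε) * Real.logb 2 (Real.logb 2 ((k : ℝ) + 1))) := by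
      rw [mul_comm (t * (1 + ε)), Real.rpow_mul zero_le_two,
        Real.rpow_logb two_pos (by norm_num) (hY k)]
    rw [e1, e2, ← Real.rpow_add two_pos, ← Real.rpow_add two_pos]
    refine Real.rpow_le_rpow_of_exponent_le one_le_two ?_
    have := mul_le_mul_of_nonneg_left (hC k) ht.le
    rw [lengthProfile] at this
    linarith
  calc _ ≤ ∫⁻ ω, ENNReal.ofReal (2 ^ (t * lengthConst ε)) *
          (f (pfrIndex P Q T X ω) * g (pfrIndex P Q T X ω)) ∂μ := lintegral_mono fun ω => hpt _
    _ = ENNReal.ofReal (2 ^ (t * lengthConst ε)) *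
          ∫⁻ ω, f (pfrIndex P Q T X ω) * g (pfrIndex P Q T X ω) ∂μ :=
        lintegral_const_mul' _ _ ENNReal.ofReal_ne_top
    _ ≤ ENNReal.ofReal (2 ^ (t * lengthConst ε)) *
          ((∫⁻ ω, f (pfrIndex P Q T X ω) ^ (2 : ℝ) ∂μ) ^ (1 / 2 : ℝ) *
          (∫⁻ ω, g (pfrIndex P Q T X ω) ^ (2 : ℝ) ∂μ) ^ (1 / 2 : ℝ)) := by
        gcongr
        exact ENNReal.lintegral_mul_le_Lp_mul_Lq μ Real.HolderConjugate.two_two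
          (h.measurable_comp_pfrIndex f).aemeasurable (h.measurable_comp_pfrIndex g).aemeasurable
    _ ≤ ENNReal.ofReal (2 ^ (t * lengthConst ε)) *
          ((ENNReal.ofReal (2 ^ (2 * t)) *
            ∫⁻ u, P.rnDeriv Q u ^ (1 + 2 * t) ∂Q) ^ (1 / 2 : ℝ) *
          (ENNReal.ofReal (((klBits P Q).toReal + 2) ^ (2 * (t * (1 + ε))))) ^ (1 / 2 : ℝ)) := by
        gcongr
        · simp only [hf]
          exact h.lintegral_rpow_pfrIndex_le hPQ (by linarith) ht2
        · simp only [hg]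
          exact lintegral_ofReal_rpow_le (fun ω => (hY _).le) (by positivity) (by positivity) htε
            (h.lintegral_logb_add_one_le hPQ hD)
    _ = _ := by
        rw [ENNReal.mul_rpow_of_nonneg _ _ (by norm_num),
          ENNReal.ofReal_rpow_of_nonneg (by positivity) (by norm_num),
          ENNReal.ofReal_rpow_of_nonneg (by positivity) (by norm_num),
          ← Real.rpow_mul zero_le_two, ← Real.rpow_mul (by positivity),
          show 2 * t * (1 / 2) = t by ring,
          show 2 * (t * (1 + ε)) * (1 / 2) = t * (1 + ε) by ring,
          mul_add t (lengthConst ε), mul_one, Real.rpow_add two_pos,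
          ENNReal.ofReal_mul (by positivity),
          ENNReal.ofReal_mul (by positivity)]
        ring

theorem IsPoissonSource.expectedLength_le (h : IsPoissonSource μ Q T X) (hPQ : P ≪ Q)
    (hε : 0 < ε) (hC : ∀ k : ℕ+, ((C k).length : ℝ) ≤ lengthProfile ε k + lengthConst ε) :
    ((expectedLength μ (pfrIndex P Q T X) C : ℝ≥0∞) : EReal) ≤
      ((klBits P Q : ℝ≥0∞) : EReal)
        + ((1 + ε : ℝ) : EReal) * log2E (klBits P Q + 1) + ((c2 ε : ℝ) : EReal) := by
  by_cases hD : klBits P Q = ∞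
  · rw [hD, coe_mul_log2E_top_add hε (by simp)]
    exact le_top
  · have hd : (0 : ℝ) ≤ (klBits P Q).toReal := ENNReal.toReal_nonneg
    have hnn : 0 ≤ (klBits P Q).toReal + (1 + ε) * Real.logb 2 ((klBits P Q).toReal + 1) + c2 ε := by
      have h1 : 0 ≤ Real.logb 2 ((klBits P Q).toReal + 1) :=
        Real.logb_nonneg (by norm_num) (by linarith)
      have h2 := lengthConst_nonneg hε
      rw [c2_eq]
      positivity
    have := EReal.coe_ennreal_le_coe_ennreal_iff.mpr (h.lintegral_length_le hPQ hε hC hD)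
    refine this.trans (le_of_eq ?_)
    rw [EReal.coe_ennreal_ofReal, max_eq_left hnn, log2E_klBits_add_one hD, EReal.coe_add,
      EReal.coe_add, EReal.coe_mul, EReal.coe_ennreal_toReal hD]

/-- The square root from Cauchy–Schwarz turns 1/t into 1/(2t), the normalization of the Rényi
divergence of order 1 + 2t. The passage from D + 2 to D + 1 inside the logarithm costs 1 + ε, and
2^t from the moment bound costs 1. -/
theorem IsPoissonSource.campbellCost_le (h : IsPoissonSource μ Q T X) (hPQ : P ≪ Q)
    (hε : 0 < ε) (hC : ∀ k : ℕ+, ((C k).length : ℝ) ≤ lengthProfile ε k + lengthConst ε)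
    {t : ℝ} (ht : 0 < t) (ht2 : 2 * t < 1) (htε : 2 * (t * (1 + ε)) ≤ 1) :
    campbellCost μ (pfrIndex P Q T X) C t ≤ renyiDiv (1 + 2 * t) P Q
      + ((1 + ε : ℝ) : EReal) * log2E (klBits P Q + 1) + ((c2 ε : ℝ) : EReal) := by
  have hβ : 1 < 1 + 2 * t := by linarith
  by_cases hD : klBits P Q = ∞
  · rw [hD, coe_mul_log2E_top_add hε (renyiDiv_ne_bot hPQ hβ)]
    exact le_top
  have hd : (0 : ℝ) ≤ (klBits P Q).toReal := ENNReal.toReal_nonneg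
  by_cases hI : ∫⁻ u, P.rnDeriv Q u ^ (1 + 2 * t) ∂Q = ∞
  · rw [renyiDiv_eq_top hβ hI, log2E_klBits_add_one hD, ← EReal.coe_mul, EReal.top_add_coe,
      EReal.top_add_coe]
    exact le_top
  have hI0 := lintegral_rnDeriv_rpow_ne_zero hPQ (show 0 < 1 + 2 * t by linarith)
  have hb := h.lintegral_two_rpow_length_le hPQ hε hC hD ht ht2 htε
  rw [renyiDiv_eq_coe hPQ hβ hI, log2E_klBits_add_one hD, campbellCost]
  set i := (∫⁻ u, P.rnDeriv Q u ^ (1 + 2 * t) ∂Q).toReal with hi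
  have hipos : 0 < i := ENNReal.toReal_pos hI0 hI
  rw [← ENNReal.ofReal_toReal hI, ← hi, ENNReal.ofReal_rpow_of_pos hipos,
    ← ENNReal.ofReal_mul (by positivity)] at hb
  have hlog := log2E_mono hb
  rw [log2E_ofReal (by positivity)] at hlog
  refine (mul_le_mul_of_nonneg_left hlog
    (by exact_mod_cast (inv_pos.mpr ht).le)).trans ?_
  rw [← EReal.coe_mul, ← EReal.coe_mul, ← EReal.coe_add, ← EReal.coe_add, EReal.coe_le_coe_iff,
    Real.logb_mul (by positivity) (by positivity), Real.logb_mul (by positivity) (by positivity),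
    Real.logb_rpow (by norm_num) (by norm_num), Real.logb_rpow_eq_mul_logb_of_pos (by positivity),
    Real.logb_rpow_eq_mul_logb_of_pos hipos, c2_eq]
  have := mul_le_mul_of_nonneg_left (logb_add_two_le hd) (show 0 ≤ 1 + ε by linarith)
  have e : t⁻¹ * (t * (lengthConst ε + 1) + t * (1 + ε) * Real.logb 2 ((klBits P Q).toReal + 2) +
      1 / 2 * Real.logb 2 i) = lengthConst ε + 1 +
      (1 + ε) * Real.logb 2 ((klBits P Q).toReal + 2) + (1 + 2 * t - 1)⁻¹ * Real.logb 2 i := by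
    rw [show 1 + 2 * t - 1 = 2 * t by ring]
    field_simp
  rw [e]
  linarith

end Bounds

/-! ### Cumulant generating functions near zero. -/

section CumulantLimit

variable {Ω : Type*} [MeasurableSpace Ω] {μ : Measure Ω} {Z : Ω → ℝ}

lemma zero_mem_interior_integrableExpSet [IsProbabilityMeasure μ] {a b : ℝ} (ha : a < 0)
    (hb : 0 < b) (hia : Integrable (fun ω => Real.exp (a * Z ω)) μ)
    (hib : Integrable (fun ω => Real.exp (b * Z ω)) μ) :
    0 ∈ interior (integrableExpSet Z μ) := by
  rw [mem_interior_iff_mem_nhds]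
  filter_upwards [Icc_mem_nhds ha hb] with s hs
  exact integrable_exp_mul_of_le_of_le hia hib hs.1 hs.2

/-- The difference quotient at 0 of the cumulant generating function, whose derivative there is the
mean. -/
lemma tendsto_cgf_div [IsProbabilityMeasure μ] (h : 0 ∈ interior (integrableExpSet Z μ)) :
    Tendsto (fun s => s⁻¹ * cgf Z μ s) (𝓝[>] 0) (𝓝 (∫ ω, Z ω ∂μ)) := by
  have hd : HasDerivAt (cgf Z μ) (∫ ω, Z ω ∂μ) 0 := by
    have h1 := (analyticAt_cgf h).differentiableAt.hasDerivAt
    rw [deriv_cgf_zero h] at h1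
    simpa using h1
  simpa using hd.tendsto_slope_zero_right

lemma ofReal_mgf {s : ℝ} (h : Integrable (fun ω => Real.exp (s * Z ω)) μ) :
    ENNReal.ofReal (mgf Z μ s) = ∫⁻ ω, ENNReal.ofReal (Real.exp (s * Z ω)) ∂μ :=
  ofReal_integral_eq_lintegral_ofReal h (ae_of_all _ fun _ => (Real.exp_pos _).le)

lemma tendsto_order_nhdsGT (c : ℝ) (hc : 0 < c) :
    Tendsto (fun α : ℝ => c * ((1 - α) / α)) (𝓝[<] 1) (𝓝[>] 0) := by
  refine tendsto_nhdsWithin_iff.mpr ⟨?_, ?_⟩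
  · have : Tendsto (fun α : ℝ => c * ((1 - α) / α)) (𝓝 1) (𝓝 (c * ((1 - 1) / 1))) :=
      (tendsto_const_nhds.mul ((tendsto_const_nhds.sub tendsto_id).div tendsto_id one_ne_zero))
    simpa using this.mono_left nhdsWithin_le_nhds
  · filter_upwards [Ioo_mem_nhdsLT (show (0 : ℝ) < 1 by norm_num)] with α hα
    exact mul_pos hc (div_pos (by linarith [hα.2]) hα.1)

end CumulantLimit

/-! ### The Rényi divergence tends to the Kullback–Leibler divergence. -/

section LogLikelihood

variable {U : Type*} [MeasurableSpace U] {P Q : Measure U} [IsProbabilityMeasure P]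
  [IsProbabilityMeasure Q]

/-- Change of measure, E_P r^s = E_Q r^(1+s). It makes D_(1+s) the cumulant generating function of
the log-likelihood ratio under P, divided by s ln 2. -/
lemma lintegral_exp_llr (hPQ : P ≪ Q) {s : ℝ} (hs : 0 < s) :
    ∫⁻ u, ENNReal.ofReal (Real.exp (s * llr P Q u)) ∂P = ∫⁻ u, P.rnDeriv Q u ^ (1 + s) ∂Q := by
  have h1 : ∫⁻ u, ENNReal.ofReal (Real.exp (s * llr P Q u)) ∂P = ∫⁻ u, P.rnDeriv Q u ^ s ∂P := by
    refine lintegral_congr_ae ?_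
    filter_upwards [exp_llr_of_ac P Q hPQ, hPQ.ae_le (Measure.rnDeriv_lt_top P Q)] with u hu hu'
    rw [mul_comm, Real.exp_mul, hu, ← ENNReal.ofReal_rpow_of_nonneg ENNReal.toReal_nonneg hs.le,
      ENNReal.ofReal_toReal hu'.ne]
  rw [h1, ← lintegral_rnDeriv_mul hPQ (by fun_prop)]
  refine lintegral_congr fun u => ?_
  rw [ENNReal.rpow_add_of_nonneg _ _ zero_le_one hs.le, ENNReal.rpow_one]

lemma integrable_exp_llr_iff (hPQ : P ≪ Q) {s : ℝ} (hs : 0 < s) :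
    Integrable (fun u => Real.exp (s * llr P Q u)) P ↔ ∫⁻ u, P.rnDeriv Q u ^ (1 + s) ∂Q ≠ ∞ := by
  rw [← lintegral_exp_llr hPQ hs, lintegral_ofReal_ne_top_iff_integrable (by fun_prop)
    (ae_of_all _ fun _ => (Real.exp_pos _).le)]

/-- Under P the integrand is dQ/dP. This supplies the negative exponential moment. -/
lemma integrable_exp_neg_llr (hPQ : P ≪ Q) :
    Integrable (fun u => Real.exp (-1 * llr P Q u)) P := by
  refine (integrable_congr ?_).mpr (Measure.integrable_toReal_rnDeriv (μ := Q) (ν := P))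
  filter_upwards [exp_neg_llr hPQ] with u hu
  rw [neg_one_mul, hu]

/-- If some Rényi divergence is finite, then the log-likelihood ratio has exponential moments. -/
lemma exists_integrable_exp_llr (hPQ : P ≪ Q) (h : ∃ β : ℝ, 1 < β ∧ renyiDiv β P Q ≠ ⊤) :
    ∃ b : ℝ, 0 < b ∧ ∀ s, 0 ≤ s → s ≤ b → Integrable (fun u => Real.exp (s * llr P Q u)) P := by
  obtain ⟨β, hβ, h⟩ := h
  refine ⟨β - 1, by linarith, fun s hs hs' => integrable_exp_mul_of_le_of_le
    (integrable_exp_neg_llr hPQ) ((integrable_exp_llr_iff hPQ (by linarith)).mpr fun htop => h ?_)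
    (by linarith) hs'⟩
  rw [show 1 + (β - 1) = β by ring] at htop
  exact renyiDiv_eq_top hβ htop

lemma zero_mem_interior_llr (hPQ : P ≪ Q) (h : ∃ β : ℝ, 1 < β ∧ renyiDiv β P Q ≠ ⊤) :
    0 ∈ interior (integrableExpSet (llr P Q) P) := by
  obtain ⟨b, hb, hb'⟩ := exists_integrable_exp_llr hPQ h
  exact zero_mem_interior_integrableExpSet (a := -1) (by norm_num) hb (integrable_exp_neg_llr hPQ)
    (hb' b hb.le le_rfl)

lemma klBits_ne_top (hPQ : P ≪ Q) (h : ∃ β : ℝ, 1 < β ∧ renyiDiv β P Q ≠ ⊤) :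
    klBits P Q ≠ ∞ := by
  have := InformationTheory.klDiv_ne_top hPQ
    (integrable_of_mem_interior_integrableExpSet (zero_mem_interior_llr hPQ h))
  exact ENNReal.div_ne_top this (by simpa using Real.log_pos (by norm_num))

lemma toReal_klBits (hPQ : P ≪ Q) :
    (klBits P Q).toReal = (∫ u, llr P Q u ∂P) / Real.log 2 := by
  rw [klBits, ENNReal.toReal_div, InformationTheory.toReal_klDiv_of_measure_eq hPQ (by simp),
    ENNReal.toReal_ofReal (Real.log_nonneg (by norm_num))]

lemma tendsto_renyiDiv (hPQ : P ≪ Q) (h : ∃ β : ℝ, 1 < β ∧ renyiDiv β P Q ≠ ⊤) (c : ℝ) :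
    Tendsto (fun α : ℝ => renyiDiv ((2 - α) / α) P Q + (c : EReal)) (𝓝[<] 1)
      (𝓝 (((klBits P Q : ℝ≥0∞) : EReal) + (c : EReal))) := by
  obtain ⟨b, hb, hb'⟩ := exists_integrable_exp_llr hPQ h
  -- The order (2-α)/α is 1 + s with s = 2(1-α)/α. The constant is added in ℝ, before the cast to
  -- `EReal`.
  have hlim := (((tendsto_cgf_div (zero_mem_interior_llr hPQ h)).comp
    (tendsto_order_nhdsGT 2 two_pos)).div_const (Real.log 2)).add_const c
  rw [← toReal_klBits hPQ] at hlim
  have hlim' := EReal.tendsto_coe.mpr hlim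
  rw [EReal.coe_add, EReal.coe_ennreal_toReal (klBits_ne_top hPQ h)] at hlim'
  refine hlim'.congr' ?_
  filter_upwards [Ioo_mem_nhdsLT (show (0 : ℝ) < 1 by norm_num),
    (tendsto_order_nhdsGT 2 two_pos).eventually (Ioc_mem_nhdsGT hb)] with α hα hs
  set s := 2 * ((1 - α) / α) with hsdef
  have e : (2 - α) / α = 1 + s := by
    have := hα.1.ne'
    rw [hsdef]
    field_simp
    ring
  have hi := hb' s hs.1.le hs.2
  have hne := (integrable_exp_llr_iff hPQ hs.1).mp hi
  have hm : (∫⁻ u, P.rnDeriv Q u ^ (1 + s) ∂Q).toReal = mgf (llr P Q) P s := by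
    rw [← lintegral_exp_llr hPQ hs.1, ← ofReal_mgf hi, ENNReal.toReal_ofReal mgf_nonneg]
  rw [e, renyiDiv_eq_coe hPQ (by linarith [hs.1]) hne, hm, ← EReal.coe_add]
  simp only [Function.comp, cgf, Real.logb, ← hsdef]
  congr 2
  rw [show 1 + s - 1 = s by ring]
  ring

end LogLikelihood

/-! ### The Campbell cost tends to the expected length. -/

section CampbellLimit

variable {Ω U : Type*} [MeasurableSpace Ω] [MeasurableSpace U] {μ : Measure Ω}
  {P Q : Measure U} {T : ℕ → Ω → ℝ} {X : ℕ → Ω → U} [IsProbabilityMeasure μ]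
  [IsProbabilityMeasure P] [IsProbabilityMeasure Q] {ε : ℝ} {C : ℕ+ → List Bool}

lemma two_rpow_mul_natCast (t : ℝ) (n : ℕ) :
    (2 : ℝ≥0∞) ^ (t * (n : ℝ)) = ENNReal.ofReal (Real.exp (Real.log 2 * t * n)) := by
  rw [← ENNReal.ofReal_ofNat 2, ENNReal.ofReal_rpow_of_pos zero_lt_two,
    Real.rpow_def_of_pos zero_lt_two, mul_assoc]

theorem IsPoissonSource.tendsto_campbellCost (h : IsPoissonSource μ Q T X) (hPQ : P ≪ Q)
    (hε : 0 < ε) (hC : ∀ k : ℕ+, ((C k).length : ℝ) ≤ lengthProfile ε k + lengthConst ε)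
    (hβ : ∃ β : ℝ, 1 < β ∧ renyiDiv β P Q ≠ ⊤) :
    Tendsto (fun α : ℝ => campbellCost μ (pfrIndex P Q T X) C ((1 - α) / α)) (𝓝[<] 1)
      (𝓝 ((expectedLength μ (pfrIndex P Q T X) C : ℝ≥0∞) : EReal)) := by
  have hl : 0 < Real.log 2 := Real.log_pos (by norm_num)
  have hZm : Measurable fun ω => ((C (pfrIndex P Q T X ω)).length : ℝ) :=
    h.measurable_comp_pfrIndex fun k => ((C k).length : ℝ)
  set Z : Ω → ℝ := fun ω => ((C (pfrIndex P Q T X ω)).length : ℝ) with hZ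
  have hZ0 : ∀ ω, 0 ≤ Z ω := fun ω => Nat.cast_nonneg _
  obtain ⟨b, hb, hb'⟩ := exists_integrable_exp_llr hPQ hβ
  obtain ⟨t, ht, ht1, ht2, ht3⟩ : ∃ t : ℝ, 0 < t ∧ 2 * t < 1 ∧ 2 * (t * (1 + ε)) ≤ 1 ∧ 2 * t ≤ b := by
    -- The first entry secures both exponent conditions; the second keeps 2t where r has a finite
    -- moment of order 1 + 2t.
    refine ⟨min (1 / (4 * (1 + ε))) (b / 2), by positivity, ?_, ?_, ?_⟩
    · have h1 : 1 / (4 * (1 + ε)) < 1 / 2 := by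
        rw [div_lt_div_iff₀ (by positivity) two_pos]; linarith
      linarith [min_le_left (1 / (4 * (1 + ε))) (b / 2)]
    · calc 2 * (min (1 / (4 * (1 + ε))) (b / 2) * (1 + ε)) ≤ 2 * (1 / (4 * (1 + ε)) * (1 + ε)) := by
            gcongr
            exact min_le_left _ _
        _ ≤ 1 := by
            have : (1 + ε) ≠ 0 := by positivity
            field_simp
            norm_num
    · linarith [min_le_right (1 / (4 * (1 + ε))) (b / 2)]
  have hib : Integrable (fun ω => Real.exp (Real.log 2 * t * Z ω)) μ := by
    rw [← lintegral_ofReal_ne_top_iff_integrable (by fun_prop)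
      (ae_of_all _ fun _ => (Real.exp_pos _).le)]
    have := h.lintegral_two_rpow_length_le hPQ hε hC (klBits_ne_top hPQ hβ) ht ht1 ht2
    simp only [two_rpow_mul_natCast] at this
    refine ne_top_of_le_ne_top (ENNReal.mul_ne_top ENNReal.ofReal_ne_top
      (ENNReal.rpow_ne_top_of_nonneg (by norm_num) ?_)) this
    exact (integrable_exp_llr_iff hPQ (by positivity)).mp (hb' _ (by positivity) ht3)
  have hia : Integrable (fun ω => Real.exp (-1 * Z ω)) μ := by
    refine Integrable.of_bound (by fun_prop) 1 (ae_of_all _ fun ω => ?_)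
    rw [Real.norm_of_nonneg (Real.exp_pos _).le, Real.exp_le_one_iff]
    linarith [hZ0 ω]
  have hint := zero_mem_interior_integrableExpSet (by norm_num) (mul_pos hl ht) hia hib
  have hEZ : ((∫ ω, Z ω ∂μ : ℝ) : EReal) =
      ((expectedLength μ (pfrIndex P Q T X) C : ℝ≥0∞) : EReal) := by
    have h1 : expectedLength μ (pfrIndex P Q T X) C = ENNReal.ofReal (∫ ω, Z ω ∂μ) := by
      rw [ofReal_integral_eq_lintegral_ofReal (integrable_of_mem_interior_integrableExpSet hint)
        (ae_of_all _ hZ0)]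
      simp [expectedLength, hZ]
    rw [h1, EReal.coe_ennreal_ofReal, max_eq_left (integral_nonneg hZ0)]
  rw [← hEZ]
  have hlim := EReal.tendsto_coe.mpr ((tendsto_cgf_div hint).comp
    (tendsto_order_nhdsGT (Real.log 2) hl))
  refine hlim.congr' ?_
  filter_upwards [(tendsto_order_nhdsGT (Real.log 2) hl).eventually
    (Ioc_mem_nhdsGT (mul_pos hl ht))] with α hs
  set s := (1 - α) / α with hsdef
  have hi : Integrable (fun ω => Real.exp (Real.log 2 * s * Z ω)) μ :=
    integrable_exp_mul_of_le_of_le hia hib (by linarith [hs.1]) hs.2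
  have hm : ∫⁻ ω, (2 : ℝ≥0∞) ^ (s * ((C (pfrIndex P Q T X ω)).length : ℝ)) ∂μ =
      ENNReal.ofReal (mgf Z μ (Real.log 2 * s)) := by
    rw [ofReal_mgf hi]
    exact lintegral_congr fun ω => two_rpow_mul_natCast _ _
  rw [campbellCost, hm, log2E_ofReal (mgf_pos hi), ← EReal.coe_mul]
  simp only [Function.comp, cgf, Real.logb, ← hsdef]
  congr 1
  rw [mul_inv]
  ring

end CampbellLimit

/-! ### Kraft's theorem. -/

section Kraft

/-- The `n` lowest binary digits of `m`, the most significant one first. -/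
def bitList (n m : ℕ) : List Bool := List.ofFn fun i : Fin n => m.testBit (n - 1 - i)

lemma length_bitList (n m : ℕ) : (bitList n m).length = n := by simp [bitList]

lemma eq_div_of_bitList_prefix {a b m n : ℕ} (hm : m < 2 ^ a) (hn : n < 2 ^ b)
    (h : bitList a m <+: bitList b n) : a ≤ b ∧ m = n / 2 ^ (b - a) := by
  have hab : a ≤ b := by simpa [length_bitList] using h.length_le
  refine ⟨hab, Nat.eq_of_testBit_eq fun i => ?_⟩
  rw [Nat.testBit_div_two_pow]
  by_cases hi : i < a
  · have h1 := h.getElem (i := a - 1 - i) (by rw [length_bitList]; omega)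
    simp only [bitList, List.getElem_ofFn] at h1
    rw [show a - 1 - (a - 1 - i) = i by omega, show b - 1 - (a - 1 - i) = i + (b - a) by omega] at h1
    exact h1
  · rw [Nat.testBit_lt_two_pow (lt_of_lt_of_le hm (Nat.pow_le_pow_right two_pos (not_lt.mp hi))),
      Nat.testBit_lt_two_pow (lt_of_lt_of_le hn (Nat.pow_le_pow_right two_pos (by omega)))]

/-- Kraft's theorem: nondecreasing codeword lengths that satisfy Kraft's inequality are those of
a prefix-free code. -/
lemma exists_prefixFree_of_kraft {l : ℕ → ℕ} (hl : Monotone l)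
    (hk : ∀ n, ∑ j ∈ Finset.range n, (2 : ℝ)⁻¹ ^ l j ≤ 1) :
    ∃ C : ℕ → List Bool, (∀ k, (C k).length = l k) ∧ ∀ j k, C j <+: C k → j = k := by
  -- `m k` / 2^(`l k`) is the partial Kraft sum over j < k; its binary digits form codeword `k`.
  set m : ℕ → ℕ := fun k => ∑ j ∈ Finset.range k, 2 ^ (l k - l j) with hm
  have hlt : ∀ k, m k < 2 ^ l k := by
    intro k
    have h1 := hk (k + 1)
    rw [Finset.sum_range_succ] at h1
    have h2 : ((m k + 1 : ℕ) : ℝ) = (2 : ℝ) ^ l k *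
        (∑ j ∈ Finset.range k, (2 : ℝ)⁻¹ ^ l j + 2⁻¹ ^ l k) := by
      rw [mul_add, Finset.mul_sum, ← mul_pow, mul_inv_cancel₀ two_ne_zero, one_pow, hm]
      push_cast
      congr 1
      refine Finset.sum_congr rfl fun j hj => ?_
      rw [pow_sub₀ _ two_ne_zero (hl (Finset.mem_range.mp hj).le), inv_pow]
    have h3 : ((m k + 1 : ℕ) : ℝ) ≤ ((2 ^ l k : ℕ) : ℝ) := by
      rw [h2]
      push_cast
      exact mul_le_of_le_one_right (by positivity) h1
    exact Nat.lt_of_succ_le (by exact_mod_cast h3)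
  -- The dyadic interval of `k` begins at or after the end of that of `j`, so codeword `j` is not a
  -- prefix of codeword `k`.
  have hstep : ∀ {j k}, j < k → (m j + 1) * 2 ^ (l k - l j) ≤ m k := by
    intro j k hjk
    calc (m j + 1) * 2 ^ (l k - l j) = ∑ i ∈ Finset.range (j + 1), 2 ^ (l k - l i) := by
          rw [Finset.sum_range_succ, add_mul, one_mul, hm, Finset.sum_mul]
          congr 1
          refine Finset.sum_congr rfl fun i hi => ?_
          have h1 := hl (Finset.mem_range.mp hi).le
          have h2 := hl hjk.le
          rw [← pow_add]
          congr 1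
          omega
      _ ≤ m k := Finset.sum_le_sum_of_subset (Finset.range_mono hjk)
  refine ⟨fun k => bitList (l k) (m k), fun k => length_bitList _ _, fun j k hjk => ?_⟩
  obtain ⟨h1, h2⟩ := eq_div_of_bitList_prefix (hlt j) (hlt k) hjk
  rcases lt_trichotomy j k with h | h | h
  · have := (Nat.le_div_iff_mul_le (by positivity)).mpr (hstep h)
    omega
  · exact h
  · have h3 := hstep h
    have h4 := hl h.le
    rw [show l j - l k = 0 by omega] at h3
    rw [show l k - l j = 0 by omega] at h2
    simp at h2 h3
    omega

end Kraft

/-! ### The Kraft sum of the length profile. -/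

section Series

/-- Convexity of x^(-ε), compared with its tangent at `v`. With logarithms of consecutive integers
it gives a telescoping bound in place of an integral test. -/
lemma rpow_neg_tangent {u v ε : ℝ} (hu : 0 < u) (hv : 0 < v) (hε : 0 < ε) :
    ε * v ^ (-(1 + ε)) * (v - u) ≤ u ^ (-ε) - v ^ (-ε) := by
  have h1 : 1 - ε * (u / v - 1) ≤ (u / v) ^ (-ε) := by
    rw [Real.rpow_def_of_pos (by positivity)]
    have h2 := Real.add_one_le_exp (Real.log (u / v) * -ε)
    have h3 := mul_le_mul_of_nonneg_left (Real.log_le_sub_one_of_pos (div_pos hu hv)) hε.le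
    linarith
  rw [Real.div_rpow hu.le hv.le, le_div_iff₀ (by positivity)] at h1
  have e : v ^ (-ε) = v ^ (-(1 + ε)) * v := by
    rw [← Real.rpow_add_one hv.ne']; ring_nf
  have e2 : (1 - ε * (u / v - 1)) * v ^ (-ε) = v ^ (-ε) + ε * v ^ (-(1 + ε)) * (v - u) := by
    rw [sub_mul, one_mul]
    nth_rewrite 2 [e]
    field_simp
    ring
  linarith

lemma inv_le_logb_sub {k : ℝ} (hk : 1 < k) :
    (Real.log 2)⁻¹ * k⁻¹ ≤ Real.logb 2 k - Real.logb 2 (k - 1) := by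
  have hl : 0 < Real.log 2 := Real.log_pos (by norm_num)
  have h := Real.one_sub_inv_le_log_of_pos (x := k / (k - 1)) (div_pos (by linarith) (by linarith))
  rw [Real.log_div (by linarith) (by linarith), inv_div, sub_div, div_self (by linarith)] at h
  rw [Real.logb, Real.logb, ← sub_div, div_eq_inv_mul]
  refine mul_le_mul_of_nonneg_left ?_ (by positivity)
  rw [inv_eq_one_div]
  linarith

lemma sum_inv_mul_logb_le {ε : ℝ} (hε : 0 < ε) (N : ℕ) :
    ∑ n ∈ Finset.range (N + 2), ((n : ℝ) + 1)⁻¹ * Real.logb 2 ((n : ℝ) + 2) ^ (-(1 + ε)) ≤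
      3 / 2 + Real.log 2 / ε * (1 - Real.logb 2 ((N : ℝ) + 2) ^ (-ε)) := by
  have hl : 0 < Real.log 2 := Real.log_pos (by norm_num)
  induction N with
  -- The terms k = 1 and k = 2 are at most 1 and 1/2, whence 3/2; the telescoping part starts at
  -- zero because log₂ 2 = 1.
  | zero =>
    have h3 : 1 ≤ Real.logb 2 3 := by
      rw [Real.le_logb_iff_rpow_le (by norm_num) (by norm_num)]; norm_num
    have h4 : Real.logb 2 3 ^ (-ε + -1) ≤ 1 :=
      Real.rpow_le_one_of_one_le_of_nonpos h3 (by linarith)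
    simp [Finset.sum_range_succ]
    norm_num
    linarith
  | succ N ih =>
    rw [Finset.sum_range_succ]
    have hu : 1 ≤ Real.logb 2 ((N : ℝ) + 2) := by
      rw [Real.le_logb_iff_rpow_le (by norm_num) (by positivity), Real.rpow_one]
      linarith [Nat.cast_nonneg (α := ℝ) N]
    have huv : Real.logb 2 ((N : ℝ) + 2) ≤ Real.logb 2 ((N : ℝ) + 3) :=
      Real.logb_le_logb_of_le (by norm_num) (by positivity) (by linarith)
    have hvw : Real.logb 2 ((N : ℝ) + 3) ≤ Real.logb 2 ((N : ℝ) + 4) :=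
      Real.logb_le_logb_of_le (by norm_num) (by positivity) (by linarith)
    have h1 := rpow_neg_tangent (u := Real.logb 2 ((N : ℝ) + 2)) (v := Real.logb 2 ((N : ℝ) + 3))
      (by linarith) (by linarith) hε
    have h2 := inv_le_logb_sub (k := (N : ℝ) + 3) (by linarith [Nat.cast_nonneg (α := ℝ) N])
    rw [show (N : ℝ) + 3 - 1 = N + 2 by ring] at h2
    have h3 : Real.logb 2 ((N : ℝ) + 4) ^ (-(1 + ε)) ≤ Real.logb 2 ((N : ℝ) + 3) ^ (-(1 + ε)) :=
      Real.rpow_le_rpow_of_nonpos (by linarith) hvw (by linarith)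
    have hvp : 0 < Real.logb 2 ((N : ℝ) + 3) ^ (-(1 + ε)) := Real.rpow_pos_of_pos (by linarith) _
    have h4 : ((N : ℝ) + 3)⁻¹ * Real.logb 2 ((N : ℝ) + 4) ^ (-(1 + ε)) ≤
        Real.log 2 / ε * (Real.logb 2 ((N : ℝ) + 2) ^ (-ε) - Real.logb 2 ((N : ℝ) + 3) ^ (-ε)) := by
      calc _ ≤ ((N : ℝ) + 3)⁻¹ * Real.logb 2 ((N : ℝ) + 3) ^ (-(1 + ε)) := by gcongr
        _ = Real.log 2 / ε * (ε * Real.logb 2 ((N : ℝ) + 3) ^ (-(1 + ε)) *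
            ((Real.log 2)⁻¹ * ((N : ℝ) + 3)⁻¹)) := by field_simp
        _ ≤ Real.log 2 / ε * (ε * Real.logb 2 ((N : ℝ) + 3) ^ (-(1 + ε)) *
            (Real.logb 2 ((N : ℝ) + 3) - Real.logb 2 ((N : ℝ) + 2))) := by gcongr
        _ ≤ _ := by gcongr
    push_cast
    rw [show (N : ℝ) + 2 + 1 = N + 3 by ring, show (N : ℝ) + 2 + 2 = N + 4 by ring,
      show (N : ℝ) + 1 + 2 = N + 3 by ring]
    linarith

lemma sum_range_inv_mul_logb_le {ε : ℝ} (hε : 0 < ε) (N : ℕ) :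
    ∑ n ∈ Finset.range N, ((n : ℝ) + 1)⁻¹ * Real.logb 2 ((n : ℝ) + 2) ^ (-(1 + ε)) ≤
      Real.log 2 / ε + 3 / 2 := by
  have hl : 0 < Real.log 2 := Real.log_pos (by norm_num)
  have hnn : ∀ n : ℕ, 0 ≤ Real.logb 2 ((n : ℝ) + 2) := fun n =>
    Real.logb_nonneg (by norm_num) (by linarith [Nat.cast_nonneg (α := ℝ) n])
  refine (Finset.sum_le_sum_of_subset_of_nonneg (Finset.range_mono (Nat.le_add_right N 2))
    fun n _ _ => mul_nonneg (by positivity) (Real.rpow_nonneg (hnn n) _)).trans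
    ((sum_inv_mul_logb_le hε N).trans ?_)
  have h1 : 0 ≤ Real.log 2 / ε * Real.logb 2 ((N : ℝ) + 2) ^ (-ε) :=
    mul_nonneg (by positivity) (Real.rpow_nonneg (hnn N) _)
  linarith

end Series

/-! ### Construction and universality of the code. -/

section Universal

lemma monotone_lengthProfile {ε : ℝ} (hε : 0 < ε) : Monotone (lengthProfile ε) := by
  intro j k hjk
  have h : (j : ℝ) ≤ (k : ℝ) := by exact_mod_cast hjk
  have hj := one_le_logb_add_one j
  have h1 : Real.logb 2 (j : ℝ) ≤ Real.logb 2 (k : ℝ) :=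
    Real.logb_le_logb_of_le (by norm_num) (by positivity) h
  have h2 : Real.logb 2 ((j : ℝ) + 1) ≤ Real.logb 2 ((k : ℝ) + 1) :=
    Real.logb_le_logb_of_le (by norm_num) (by positivity) (by linarith)
  have h3 := Real.logb_le_logb_of_le (b := 2) (by norm_num) (by linarith) h2
  unfold lengthProfile
  gcongr

lemma two_rpow_neg_lengthProfile (ε : ℝ) (k : ℕ+) :
    (2 : ℝ) ^ (-lengthProfile ε k) =
      (k : ℝ)⁻¹ * Real.logb 2 ((k : ℝ) + 1) ^ (-(1 + ε)) := by
  have hj := one_le_logb_add_one k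
  rw [lengthProfile, neg_add, Real.rpow_add two_pos, Real.rpow_neg zero_le_two,
    Real.rpow_logb two_pos (by norm_num) (by positivity), ← neg_mul, mul_comm (-(1 + ε)),
    Real.rpow_mul zero_le_two, Real.rpow_logb two_pos (by norm_num) (by linarith)]

/-- A prefix-free code whose codeword lengths follow the length profile. -/
lemma exists_prefixFree_lengthProfile {ε : ℝ} (hε : 0 < ε) :
    ∃ C : ℕ+ → List Bool, IsPrefixFree C ∧ ∀ k : ℕ+, lengthProfile ε k ≤ ((C k).length : ℝ) ∧
        ((C k).length : ℝ) ≤ lengthProfile ε k + lengthConst ε := by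
  have hl2 : 0 < Real.log 2 := Real.log_pos (by norm_num)
  set S := Real.log 2 / ε + 3 / 2 with hS
  have hS1 : 1 ≤ S := by
    have : 0 ≤ Real.log 2 / ε := by positivity
    linarith
  have hlS : 0 ≤ Real.logb 2 S := Real.logb_nonneg (by norm_num) hS1
  have hprof : ∀ k, 0 ≤ lengthProfile ε k := fun k =>
    add_nonneg (Real.logb_nonneg (by norm_num) (one_le_pnat_cast k))
      (mul_nonneg (by linarith) (Real.logb_nonneg (by norm_num) (one_le_logb_add_one k)))
  -- The shift by log₂ S divides the Kraft sum by its bound S; rounding up costs at most 1, hence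
  -- `lengthConst`.
  set l : ℕ → ℕ := fun n => ⌈lengthProfile ε n.succPNat + Real.logb 2 S⌉₊
  have hmono : Monotone l := fun j k hjk => Nat.ceil_mono <| by
    have := monotone_lengthProfile hε (Nat.succPNat_le_succPNat.mpr hjk)
    linarith
  have hkraft : ∀ n, ∑ j ∈ Finset.range n, (2 : ℝ)⁻¹ ^ l j ≤ 1 := by
    intro n
    have hle : ∀ j : ℕ, (2 : ℝ)⁻¹ ^ l j ≤
        ((j : ℝ) + 1)⁻¹ * Real.logb 2 ((j : ℝ) + 2) ^ (-(1 + ε)) * S⁻¹ := by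
      intro j
      calc (2 : ℝ)⁻¹ ^ l j = 2 ^ (-(l j : ℝ)) := by
            rw [Real.rpow_neg zero_le_two, Real.rpow_natCast, inv_pow]
        _ ≤ 2 ^ (-(lengthProfile ε j.succPNat) - Real.logb 2 S) := by
            refine Real.rpow_le_rpow_of_exponent_le one_le_two ?_
            linarith [Nat.le_ceil (lengthProfile ε j.succPNat + Real.logb 2 S)]
        _ = _ := by
            rw [Real.rpow_sub two_pos, two_rpow_neg_lengthProfile,
              Real.rpow_logb two_pos (by norm_num) (by linarith), div_eq_mul_inv]
            simp only [Nat.succPNat_coe, Nat.succ_eq_add_one]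
            push_cast
            rw [add_assoc, one_add_one_eq_two]
    refine (Finset.sum_le_sum fun j _ => hle j).trans ?_
    rw [← Finset.sum_mul, ← div_eq_mul_inv]
    exact div_le_one_of_le₀ (sum_range_inv_mul_logb_le hε n) (by linarith)
  obtain ⟨C, hlen, hpf⟩ := exists_prefixFree_of_kraft hmono hkraft
  refine ⟨fun k => C k.natPred, fun j k hjk => PNat.natPred_injective (hpf _ _ hjk), fun k => ?_⟩
  rw [hlen]
  simp only [l, PNat.succPNat_natPred]
  refine ⟨?_, ?_⟩
  · linarith [Nat.le_ceil (lengthProfile ε k + Real.logb 2 S)]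
  · have := (Nat.ceil_lt_add_one (add_nonneg (hprof k) hlS)).le
    unfold lengthConst
    rw [← hS]
    linarith

/-- The first k probabilities are all at least p(k) and sum to at most 1. Thus log k ≤ -log p(k)
where p(k) > 0, which compares the mean of log k with the entropy. -/
lemma pmf_mul_le_one_of_antitone {p : PMF ℕ+} (hp : Antitone fun k => p k) (k : ℕ+) :
    ((k : ℕ) : ℝ≥0∞) * p k ≤ 1 := by
  calc ((k : ℕ) : ℝ≥0∞) * p k = ∑ _j ∈ Finset.Icc 1 k, p k := by simp
    _ ≤ ∑ j ∈ Finset.Icc 1 k, p j :=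
        Finset.sum_le_sum fun j hj => hp (Finset.mem_Icc.mp hj).2
    _ ≤ ∑' j, p j := ENNReal.sum_le_tsum _
    _ = 1 := p.tsum_coe

lemma pmf_mul_logb_le {p : PMF ℕ+} (hp : Antitone fun k => p k) (k : ℕ+) :
    p k * ENNReal.ofReal (Real.logb 2 (k : ℝ)) ≤
      ENNReal.ofReal (Real.negMulLog (p k).toReal / Real.log 2) := by
  have hl2 : 0 < Real.log 2 := Real.log_pos (by norm_num)
  have hfin := p.apply_ne_top k
  have h1 : (k : ℝ) * (p k).toReal ≤ 1 := by
    have := ENNReal.toReal_mono ENNReal.one_ne_top (pmf_mul_le_one_of_antitone hp k)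
    simpa using this
  have hx : 0 ≤ (p k).toReal := ENNReal.toReal_nonneg
  rw [← ENNReal.ofReal_toReal hfin, ENNReal.toReal_ofReal hx, ← ENNReal.ofReal_mul hx]
  refine ENNReal.ofReal_le_ofReal ?_
  generalize (p k).toReal = x at h1 hx
  rw [Real.logb, ← mul_div_assoc, Real.negMulLog]
  refine div_le_div_of_nonneg_right ?_ hl2.le
  rcases hx.eq_or_lt with rfl | hx
  · simp
  · have h2 : Real.log ((k : ℝ) * x) ≤ 0 := Real.log_nonpos (by positivity) h1
    rw [Real.log_mul (by positivity) hx.ne'] at h2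
    nlinarith

/-- The iterated logarithm is bounded linearly by log(k+1) ≤ log k + 1, so the length is affine in
log k, whose mean is at most the entropy. -/
lemma isUniversalCode_of_length_le {ε : ℝ} (hε : 0 < ε) {C : ℕ+ → List Bool}
    (hpf : IsPrefixFree C)
    (hC : ∀ k : ℕ+, ((C k).length : ℝ) ≤ lengthProfile ε k + lengthConst ε) :
    IsUniversalCode C := by
  have hl2 : 1 / 2 < Real.log 2 := by linarith [Real.log_two_gt_d9]
  have hc := lengthConst_nonneg hε
  refine ⟨hpf, ENNReal.ofReal (1 + 2 * (1 + ε)) + ENNReal.ofReal (2 * (1 + ε) + lengthConst ε),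
    by simp, fun p hp => ?_⟩
  have hlen : ∀ k : ℕ+, ((C k).length : ℝ≥0∞) ≤
      ENNReal.ofReal (1 + 2 * (1 + ε)) * ENNReal.ofReal (Real.logb 2 (k : ℝ)) +
        ENNReal.ofReal (2 * (1 + ε) + lengthConst ε) := by
    intro k
    have hk : 0 ≤ Real.logb 2 (k : ℝ) := Real.logb_nonneg (by norm_num) (one_le_pnat_cast k)
    have hY := one_le_logb_add_one k
    have hYk := logb_add_one_le k
    rw [← ENNReal.ofReal_mul (by positivity), ← ENNReal.ofReal_add (by positivity) (by positivity),
      ← ENNReal.ofReal_natCast]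
    refine ENNReal.ofReal_le_ofReal ((hC k).trans ?_)
    have h1 : Real.logb 2 (Real.logb 2 ((k : ℝ) + 1)) ≤ 2 * Real.logb 2 ((k : ℝ) + 1) := by
      set y := Real.logb 2 ((k : ℝ) + 1)
      rw [Real.logb, div_le_iff₀ (by linarith)]
      have := Real.log_le_sub_one_of_pos (show 0 < y by linarith)
      nlinarith
    have h2 := mul_le_mul_of_nonneg_left (h1.trans
      (mul_le_mul_of_nonneg_left hYk zero_le_two)) (show 0 ≤ 1 + ε by linarith)
    unfold lengthProfile
    linarith
  calc ∑' k, p k * ((C k).length : ℝ≥0∞)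
      ≤ ∑' k : ℕ+, (ENNReal.ofReal (1 + 2 * (1 + ε)) *
          ENNReal.ofReal (Real.negMulLog (p k).toReal / Real.log 2) +
          p k * ENNReal.ofReal (2 * (1 + ε) + lengthConst ε)) := by
        refine ENNReal.tsum_le_tsum fun k => (mul_le_mul_right (hlen k) _).trans ?_
        rw [mul_add, mul_left_comm]
        gcongr
        exact pmf_mul_logb_le hp k
    _ = ENNReal.ofReal (1 + 2 * (1 + ε)) * entropyBits p +
          ENNReal.ofReal (2 * (1 + ε) + lengthConst ε) := by
        rw [ENNReal.tsum_add, ENNReal.tsum_mul_left, ENNReal.tsum_mul_right, p.tsum_coe, one_mul,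
          entropyBits]
    _ ≤ ENNReal.ofReal (1 + 2 * (1 + ε)) * max 1 (entropyBits p) +
          ENNReal.ofReal (2 * (1 + ε) + lengthConst ε) * max 1 (entropyBits p) := by
        gcongr
        · exact le_max_right _ _
        · exact le_mul_of_one_le_right' (le_max_left _ _)
    _ = _ := by rw [add_mul]

end Universal

theorem theorem3 (ε : ℝ) (hε : 0 < ε) :
    -- a universal code, depending on `ε` only, with the claimed lengths exists
    (∃ C : ℕ+ → List Bool, IsUniversalCode C ∧
      ∀ k : ℕ+, lengthProfile ε k ≤ ((C k).length : ℝ) ∧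
        ((C k).length : ℝ) ≤ lengthProfile ε k + lengthConst ε) ∧
    -- every code with such lengths satisfies the bounds
    ∀ C : ℕ+ → List Bool,
      (∀ k : ℕ+, ((C k).length : ℝ) ≤ lengthProfile ε k + lengthConst ε) →
      ∀ (U : Type*) [TopologicalSpace U] [PolishSpace U] [MeasurableSpace U] [BorelSpace U]
        (P Q : Measure U) [IsProbabilityMeasure P] [IsProbabilityMeasure Q],
        P ≪ Q →
        ∀ (Ω : Type*) [MeasurableSpace Ω] (μ : Measure Ω) [IsProbabilityMeasure μ]
          (T : ℕ → Ω → ℝ) (X : ℕ → Ω → U), IsPoissonSource μ Q T X →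
          -- the bound on the Campbell cost
          (∀ α : ℝ, 2 / 3 < α → α < 1 → ε ≤ (3 * α - 2) / (2 - 2 * α) →
            campbellCost μ (pfrIndex P Q T X) C ((1 - α) / α) ≤
              renyiDiv ((2 - α) / α) P Q
                + ((1 + ε : ℝ) : EReal) * log2E (klBits P Q + 1) + ((c2 ε : ℝ) : EReal)) ∧
          -- the limiting bound on the expected length
          ((expectedLength μ (pfrIndex P Q T X) C : ℝ≥0∞) : EReal) ≤
              ((klBits P Q : ℝ≥0∞) : EReal)
                + ((1 + ε : ℝ) : EReal) * log2E (klBits P Q + 1) + ((c2 ε : ℝ) : EReal) ∧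
          -- both sides of the first bound converge to those of the second as `α ↑ 1`
          ((∃ β : ℝ, 1 < β ∧ renyiDiv β P Q ≠ ⊤) →
            Tendsto (fun α : ℝ => campbellCost μ (pfrIndex P Q T X) C ((1 - α) / α)) (𝓝[<] 1)
              (𝓝 ((expectedLength μ (pfrIndex P Q T X) C : ℝ≥0∞) : EReal)) ∧
            Tendsto (fun α : ℝ => renyiDiv ((2 - α) / α) P Q
                + ((1 + ε : ℝ) : EReal) * log2E (klBits P Q + 1) + ((c2 ε : ℝ) : EReal)) (𝓝[<] 1)
              (𝓝 (((klBits P Q : ℝ≥0∞) : EReal)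
                + ((1 + ε : ℝ) : EReal) * log2E (klBits P Q + 1) + ((c2 ε : ℝ) : EReal)))) := by

  refine ⟨?_, ?_⟩
  · obtain ⟨C, hpf, hC⟩ := exists_prefixFree_lengthProfile hε
    exact ⟨C, isUniversalCode_of_length_le hε hpf fun k => (hC k).2, hC⟩
  intro C hC U _ _ _ _ P Q _ _ hPQ Ω _ μ _ T X h
  refine ⟨fun α hα hα1 hαε => ?_, h.expectedLength_le hPQ hε hC, fun hβ =>
    ⟨h.tendsto_campbellCost hPQ hε hC hβ, ?_⟩⟩
  · have h0 : 0 < α := by linarith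
    have e : (2 - α) / α = 1 + 2 * ((1 - α) / α) := by
      field_simp
      ring
    rw [e]
    -- With t = (1-α)/α, 2t < 1 says α > 2/3, and 2t(1+ε) ≤ 1 is the assumed bound on ε.
    refine h.campbellCost_le hPQ hε hC (div_pos (by linarith) h0) ?_ ?_
    · rw [← mul_div_assoc, div_lt_one h0]
      linarith
    · rw [le_div_iff₀ (by linarith)] at hαε
      rw [div_mul_eq_mul_div, ← mul_div_assoc, div_le_one h0]
      linarith
  · have hlog := log2E_klBits_add_one (klBits_ne_top hPQ hβ)
    simp only [hlog, add_assoc, ← EReal.coe_mul, ← EReal.coe_add]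
    exact tendsto_renyiDiv hPQ hβ _
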